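/- Let $N\ge 1$, let $\Omega\subset\mathbb{R}^N$ be a bounded open set with $C^2$ boundary, and let $T>0$, $\epsilon>0$. Let $2^*=\frac{2N}{N-2}$ and $2^\#=\frac{2(N-1)}{N-2}$ if $N\ge 3$, and let $2^*$ and $2^\#$ be any fixed numbers greater than $2$ if $N\le 2$; write $p'=\frac{p}{p-1}$ for the conjugate exponent of $p>1$. Let $f\in C^2(\mathbb{R})$ be such that for some $0<\delta\le 2^\#-2$ and some $C>0$, $$ f(s)\ \ge\ \frac1C|s|^{\max\{1,\,2[(2^\#-\delta)'-1]\}}-C \qquad\text{and}\qquad |f''(s)|\le C\big(|s|^{2^*/2-1}+1\big)\qquad\text{for all } s\in\mathbb{R}. $$ For $u\in H^1(\Omega)$ put $$ I_\epsilon[u]=\int_\Omega\Big(\frac1\epsilon f(u)+\frac\epsilon2\|\nabla u\|^2\Big)\,dx . $$ Suppose that $$ c\in L^\infty(0,T;H^1(\Omega))\cap L^2(0,T;H^2(\Omega))\cap H^1(0,T;H^1(\Omega)^*), $$ where $\partial_t c\in L^2(0,T;H^1(\Omega)^*)$ is understood through the embeddings $H^1(\Omega)\hookrightarrow L^2(\Omega)\hookrightarrow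 H^1(\Omega)^*$, and that $\mu\in L^2(0,T;H^1(\Omega))$ satisfies, for almost every $t\in(0,T)$, $$ \int_\Omega \mu(t)\,\xi\,dx=\int_\Omega\Big(\epsilon\nabla c(t)\cdot\nabla\xi+\frac1\epsilon f'(c(t))\,\xi\Big)dx\qquad\text{for all }\xi\in H^1(\Omega) $$ (the weak form of $\mu=-\epsilon\Delta c+\frac1\epsilon f'(c)$ in $\Omega$, $\partial_n c=0$ on $\partial\Omega$). Then $c$ coincides for almost every $t\in(0,T)$ with a curve in $C([0,T];L^2(\Omega))$, again denoted by $c$, such that for every $t\in[0,T]$ one has $c(t)\in H^1(\Omega)$ and $f(c(t))\in L^1(\Omega)$; the function $t\mapsto I_\epsilon[c(t)]$ is absolutely continuous on $[0,T]$; and for almost every $t\in(0,T)$ $$ \frac{d}{dt}I_\epsilon[c(t)]=\langle\partial_t c(t),\mu(t)\rangle_{H^1(\Omega)^*,H^1(\Omega)} . $$ -/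

import Mathlib

open MeasureTheory Set
open scoped ContDiff RealInnerProductSpace

noncomputable section

namespace CahnHilliard

variable {N : ℕ}

/-- `Ω` has `C²` boundary: near each boundary point, in suitable orthonormal coordinates, `Ω` is the
region strictly above the graph of a `C²` function. Here `ν` is the direction of the last
coordinate, `⟪ν, x⟫` the last coordinate of `x`, and `x - ⟪ν, x⟫ ν` the orthogonal projection of `x`
to the hyperplane `ν^⊥` of the remaining coordinates; only the values of `γ` on that hyperplane
matter. -/
def HasC2Boundary (Ω : Set (EuclideanSpace ℝ (Fin N))) : Prop :=
  ∀ x₀ ∈ frontier Ω, ∃ (ν : EuclideanSpace ℝ (Fin N)) (γ : EuclideanSpace ℝ (Fin N) → ℝ) (r : ℝ),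
    ‖ν‖ = 1 ∧ ContDiff ℝ 2 γ ∧ 0 < r ∧
      ∀ x ∈ Metric.ball x₀ r, x ∈ Ω ↔ γ (x - ⟪ν, x⟫ • ν) < ⟪ν, x⟫

/-- Scalar test functions: `φ ∈ C_c^∞(U)`. -/
structure IsTestFunction {E : Type*} [NormedAddCommGroup E] [NormedSpace ℝ E]
    (U : Set E) (φ : E → ℝ) : Prop where
  contDiff : ContDiff ℝ ∞ φ
  hasCompactSupport : HasCompactSupport φ
  tsupport_subset : tsupport φ ⊆ U

/-- `g` is the weak gradient of `u` on `Ω`: `∫_Ω u ∂_v φ = - ∫_Ω (g · v) φ` for all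
`φ ∈ C_c^∞(Ω)` and all directions `v`. -/
def HasWeakGradient (Ω : Set (EuclideanSpace ℝ (Fin N)))
    (u : EuclideanSpace ℝ (Fin N) → ℝ)
    (g : EuclideanSpace ℝ (Fin N) → EuclideanSpace ℝ (Fin N)) : Prop :=
  ∀ φ : EuclideanSpace ℝ (Fin N) → ℝ, IsTestFunction Ω φ → ∀ v : EuclideanSpace ℝ (Fin N),
    ∫ x in Ω, u x * fderiv ℝ φ x v = - ∫ x in Ω, ⟪g x, v⟫ * φ x

section WeakGradient

variable {Ω : Set (EuclideanSpace ℝ (Fin N))}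
  {u u' : EuclideanSpace ℝ (Fin N) → ℝ}
  {g g' : EuclideanSpace ℝ (Fin N) → EuclideanSpace ℝ (Fin N)}

theorem IsTestFunction.integrable_mul_fderiv {φ : EuclideanSpace ℝ (Fin N) → ℝ}
    (hφ : IsTestFunction Ω φ) (hu : MemLp u 2 (volume.restrict Ω))
    (v : EuclideanSpace ℝ (Fin N)) :
    Integrable (fun x => u x * fderiv ℝ φ x v) (volume.restrict Ω) := by
  have h : MemLp (fun x => fderiv ℝ φ x v) 2 (volume.restrict Ω) := by
    refine Continuous.memLp_of_hasCompactSupport ?_ ?_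
    · exact (hφ.contDiff.continuous_fderiv (by simp)).clm_apply continuous_const
    · exact hφ.hasCompactSupport.fderiv_apply (𝕜 := ℝ) v
  exact hu.integrable_mul h

theorem IsTestFunction.integrable_inner_mul {φ : EuclideanSpace ℝ (Fin N) → ℝ}
    (hφ : IsTestFunction Ω φ) (hg : MemLp g 2 (volume.restrict Ω))
    (v : EuclideanSpace ℝ (Fin N)) :
    Integrable (fun x => ⟪g x, v⟫ * φ x) (volume.restrict Ω) := by
  have h : MemLp φ 2 (volume.restrict Ω) :=
    hφ.contDiff.continuous.memLp_of_hasCompactSupport hφ.hasCompactSupport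
  exact (hg.inner_const v).integrable_mul h

theorem HasWeakGradient.congr (h : HasWeakGradient Ω u g)
    (hu : u =ᵐ[volume.restrict Ω] u') (hg : g =ᵐ[volume.restrict Ω] g') :
    HasWeakGradient Ω u' g' := by
  intro φ hφ v
  have h1 : ∫ x in Ω, u' x * fderiv ℝ φ x v = ∫ x in Ω, u x * fderiv ℝ φ x v :=
    integral_congr_ae (by filter_upwards [hu] with x hx; rw [hx])
  have h2 : ∫ x in Ω, ⟪g' x, v⟫ * φ x = ∫ x in Ω, ⟪g x, v⟫ * φ x :=
    integral_congr_ae (by filter_upwards [hg] with x hx; rw [hx])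
  rw [h1, h2]
  exact h φ hφ v

theorem HasWeakGradient.zero : HasWeakGradient Ω (fun _ => 0) (fun _ => 0) := by
  intro φ _ v
  simp

theorem HasWeakGradient.add (h : HasWeakGradient Ω u g) (h' : HasWeakGradient Ω u' g')
    (hu : MemLp u 2 (volume.restrict Ω)) (hu' : MemLp u' 2 (volume.restrict Ω))
    (hg : MemLp g 2 (volume.restrict Ω)) (hg' : MemLp g' 2 (volume.restrict Ω)) :
    HasWeakGradient Ω (fun x => u x + u' x) (fun x => g x + g' x) := by
  intro φ hφ v
  simp only [add_mul, inner_add_left]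
  rw [integral_add (hφ.integrable_mul_fderiv hu v) (hφ.integrable_mul_fderiv hu' v),
    integral_add (hφ.integrable_inner_mul hg v) (hφ.integrable_inner_mul hg' v),
    h φ hφ v, h' φ hφ v, neg_add]

theorem HasWeakGradient.const_smul (h : HasWeakGradient Ω u g) (a : ℝ) :
    HasWeakGradient Ω (fun x => a * u x) (fun x => a • g x) := by
  intro φ hφ v
  simp only [mul_assoc, real_inner_smul_left]
  rw [integral_const_mul, integral_const_mul, h φ hφ v, mul_neg]

end WeakGradient

/-- `L²(Ω)`. -/
abbrev L2 (Ω : Set (EuclideanSpace ℝ (Fin N))) : Type :=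
  Lp ℝ 2 (volume.restrict Ω)

/-- `L²(Ω; ℝ^N)`. -/
abbrev L2Vec (Ω : Set (EuclideanSpace ℝ (Fin N))) : Type :=
  Lp (EuclideanSpace ℝ (Fin N)) 2 (volume.restrict Ω)

/-- The Sobolev space `H¹(Ω)`: pairs `(u, ∇u)` of an `L²` function and its weak gradient in `L²`,
with the norm `(‖u‖² + ‖∇u‖²)^(1/2)`. -/
def H1 (Ω : Set (EuclideanSpace ℝ (Fin N))) : Submodule ℝ (WithLp 2 (L2 Ω × L2Vec Ω)) where
  carrier := {w | HasWeakGradient Ω w.fst w.snd}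
  zero_mem' := HasWeakGradient.zero.congr (Lp.coeFn_zero _ _ _).symm (Lp.coeFn_zero _ _ _).symm
  add_mem' {w w'} h h' :=
    (HasWeakGradient.add h h' (Lp.memLp _) (Lp.memLp _) (Lp.memLp _) (Lp.memLp _)).congr
      (Lp.coeFn_add w.fst w'.fst).symm (Lp.coeFn_add w.snd w'.snd).symm
  smul_mem' a w h :=
    (HasWeakGradient.const_smul h a).congr
      (Lp.coeFn_smul a w.fst).symm (Lp.coeFn_smul a w.snd).symm

/-- The embedding `H¹(Ω) → L²(Ω)`. -/
def H1.toL2 {Ω : Set (EuclideanSpace ℝ (Fin N))} : H1 Ω →L[ℝ] L2 Ω :=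
  (WithLp.fstL 2 ℝ (L2 Ω) (L2Vec Ω)).comp (H1 Ω).subtypeL

/-- The weak gradient `∇ : H¹(Ω) → L²(Ω; ℝ^N)`. -/
def H1.grad {Ω : Set (EuclideanSpace ℝ (Fin N))} : H1 Ω →L[ℝ] L2Vec Ω :=
  (WithLp.sndL 2 ℝ (L2 Ω) (L2Vec Ω)).comp (H1 Ω).subtypeL

/-- The embedding `H¹(Ω) → H¹(Ω)*` of the evolution triple `H¹(Ω) ⊂ L²(Ω) ⊂ H¹(Ω)*`:
`⟨u, ξ⟩ = ∫_Ω u ξ`. -/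
def H1.toDual {Ω : Set (EuclideanSpace ℝ (Fin N))} (u : H1 Ω) : StrongDual ℝ (H1 Ω) :=
  (innerSL ℝ (H1.toL2 u)).comp H1.toL2

/-- The Sobolev space `H²(Ω)`: pairs of `u ∈ H¹(Ω)` and the family, indexed by `i`, of the weak
gradients in `L²` of the partial derivatives `∂ᵢ u`, with the norm
`(‖u‖_{H¹}² + ∑ᵢ ‖∇ ∂ᵢ u‖²)^(1/2)`. -/
def H2 (Ω : Set (EuclideanSpace ℝ (Fin N))) :
    Submodule ℝ (WithLp 2 (H1 Ω × PiLp 2 (fun _ : Fin N => L2Vec Ω))) where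
  carrier := {w | ∀ i, HasWeakGradient Ω (fun x => H1.grad w.fst x i) (w.snd i)}
  zero_mem' i := by
    refine HasWeakGradient.zero.congr ?_ (Lp.coeFn_zero _ _ _).symm
    have h0 : H1.grad (0 : WithLp 2 (H1 Ω × PiLp 2 (fun _ : Fin N => L2Vec Ω))).fst = 0 :=
      map_zero _
    rw [h0]
    filter_upwards [Lp.coeFn_zero (EuclideanSpace ℝ (Fin N)) 2 (volume.restrict Ω)] with x hx
    rw [hx]
    simp
  add_mem' {w w'} h h' i := by
    refine (HasWeakGradient.add (h i) (h' i) ?_ ?_ (Lp.memLp _) (Lp.memLp _)).congr ?_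
      (Lp.coeFn_add (w.snd i) (w'.snd i)).symm
    · exact (EuclideanSpace.proj (𝕜 := ℝ) i).comp_memLp' (Lp.memLp (H1.grad w.fst))
    · exact (EuclideanSpace.proj (𝕜 := ℝ) i).comp_memLp' (Lp.memLp (H1.grad w'.fst))
    · have h0 : H1.grad (w + w').fst = H1.grad w.fst + H1.grad w'.fst := map_add _ _ _
      rw [h0]
      filter_upwards [Lp.coeFn_add (H1.grad w.fst) (H1.grad w'.fst)] with x hx
      rw [hx]
      simp
  smul_mem' a w h i := by
    refine (HasWeakGradient.const_smul (h i) a).congr ?_ (Lp.coeFn_smul a (w.snd i)).symm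
    have h0 : H1.grad (a • w).fst = a • H1.grad w.fst := map_smul _ _ _
    rw [h0]
    filter_upwards [Lp.coeFn_smul a (H1.grad w.fst)] with x hx
    rw [hx]
    simp

/-- The embedding `H²(Ω) → H¹(Ω)`. -/
def H2.toH1 {Ω : Set (EuclideanSpace ℝ (Fin N))} : H2 Ω →L[ℝ] H1 Ω :=
  (WithLp.fstL 2 ℝ (H1 Ω) (PiLp 2 (fun _ : Fin N => L2Vec Ω))).comp (H2 Ω).subtypeL

/-- `c ∈ L²(0,T; H²(Ω))`, for a curve `c` in `H¹(Ω)`. -/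
def MemL2H2 {Ω : Set (EuclideanSpace ℝ (Fin N))} (T : ℝ) (c : ℝ → H1 Ω) : Prop :=
  ∃ w : ℝ → H2 Ω, MemLp w 2 (volume.restrict (Ioo 0 T)) ∧
    ∀ᵐ t ∂(volume.restrict (Ioo 0 T)), H2.toH1 (w t) = c t

/-- `c' = ∂ₜ c` on `(0,T)` in the weak sense, with values in `H¹(Ω)*`: for all `φ ∈ C_c^∞(0,T)`,
`∫₀ᵀ φ'(t) c(t) dt = - ∫₀ᵀ φ(t) c'(t) dt` (Bochner integrals in `H¹(Ω)*`). -/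
def IsWeakTimeDeriv {Ω : Set (EuclideanSpace ℝ (Fin N))} (T : ℝ) (c : ℝ → H1 Ω)
    (c' : ℝ → StrongDual ℝ (H1 Ω)) : Prop :=
  ∀ φ : ℝ → ℝ, IsTestFunction (Ioo 0 T) φ →
    ∫ t in Ioo 0 T, deriv φ t • H1.toDual (c t) = - ∫ t in Ioo 0 T, φ t • c' t

/-- `p = 2^*`: the Sobolev exponent `2N/(N-2)` if `N ≥ 3`, any number greater than `2` otherwise. -/
def IsSobolevExponent (N : ℕ) (p : ℝ) : Prop :=
  if 3 ≤ N then p = 2 * N / (N - 2) else 2 < p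

/-- `p = 2^#`: the trace exponent `2(N-1)/(N-2)` if `N ≥ 3`, any number greater than `2`
otherwise. -/
def IsTraceExponent (N : ℕ) (p : ℝ) : Prop :=
  if 3 ≤ N then p = 2 * (N - 1) / (N - 2) else 2 < p

/-- The regularity, coercivity and growth assumptions on the potential `f` in dimension `N`. -/
structure IsAdmissiblePotential (N : ℕ) (f : ℝ → ℝ) : Prop where
  contDiff : ContDiff ℝ 2 f
  bounds : ∃ pS pT δ C : ℝ, IsSobolevExponent N pS ∧ IsTraceExponent N pT ∧
    0 < δ ∧ δ ≤ pT - 2 ∧ 0 < C ∧ ∀ s : ℝ,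
      1 / C * |s| ^ max 1 (2 * (Real.conjExponent (pT - δ) - 1)) - C ≤ f s ∧
      |deriv (deriv f) s| ≤ C * (|s| ^ (pS / 2 - 1) + 1)

/-- The Cahn–Hilliard energy `I_ε[u] = ∫_Ω (f(u)/ε + (ε/2) ‖∇u‖²)`. -/
def energy {Ω : Set (EuclideanSpace ℝ (Fin N))} (f : ℝ → ℝ) (ε : ℝ) (u : H1 Ω) : ℝ :=
  ∫ x in Ω, (1 / ε * f (H1.toL2 u x) + ε / 2 * ‖H1.grad u x‖ ^ 2)

/-- `m` is the chemical potential of `u`, that is, `m = -ε Δu + f'(u)/ε` with `∂ₙ u = 0`, weakly: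
`∫_Ω m ξ = ∫_Ω (ε ∇u · ∇ξ + f'(u) ξ / ε)` for all `ξ ∈ H¹(Ω)`. -/
def IsChemicalPotential {Ω : Set (EuclideanSpace ℝ (Fin N))} (f : ℝ → ℝ) (ε : ℝ)
    (u m : H1 Ω) : Prop :=
  ∀ ξ : H1 Ω, ∫ x in Ω, H1.toL2 m x * H1.toL2 ξ x =
    ∫ x in Ω, (ε * ⟪H1.grad u x, H1.grad ξ x⟫ + 1 / ε * deriv f (H1.toL2 u x) * H1.toL2 ξ x)

end CahnHilliard

end

namespace CahnHilliard

open scoped ENNReal NNReal Topology Convolution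
open Filter Metric Module

variable {N : ℕ}

/-! On bounded sets of `H¹` the energy is semiconvex with respect to the `H¹*` norm, and the
chemical potential is its subgradient. If `m` is the potential of `a` and `d = b - a`, then `ε/4
‖d‖²_{H¹} - K ‖d‖²_{H¹*} ≤ I[b] - I[a] - ⟨d, m⟩` (`HasGrowth.exists_energy_sub_ge`). The Dirichlet
term is exactly quadratic. The growth of `f''` and the Sobolev embedding bound the Taylor remainder
of `∫ f` by a multiple of `‖d‖_{H¹} ‖d‖_{L²}`, and `‖d‖²_{L²} ≤ ‖d‖_{H¹*} ‖d‖_{H¹}` with Young's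
inequality absorbs the rest.

The chain rule then follows abstractly (`exists_representative_hasDerivAt`). Put `P = ‖c'‖² + ‖μ‖²`,
an integrable function of time. The inequality used at both ends of a pair of good times bounds the
increment of the energy by `∫ P` plus endpoint terms `(t - s)(P s + P t)`. Chaining through
intermediate times where `P` is at most its local average removes these terms
(`abs_sub_le_of_chain`), which gives absolute continuity along good times. The coercive term makes
`c` strongly Cauchy in `H¹` along suitable sequences of good times converging to any given time, and
the limits define the representative. At almost every time `t` the energy minus the linear pairing
with `μ t`, plus a quadratic term in the `H¹*` increment, has a local minimum at `t`, so its
derivative vanishes there.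

The Sobolev embedding (`exists_sobolev_constant`) comes from the interior cone condition. A
Gagliardo-Nirenberg argument along `N` independent directions of the cone treats smooth functions
cut off near a point; mollification into the cone, Fatou's lemma and compactness of the closure of
`Ω` do the rest. -/

/-! ### The interior cone condition -/

/-- `Ω` satisfies the interior cone condition near `x₀`: rays starting in `Ω` close to `x₀`, with
direction in the ball of radius `κ` about the unit vector `ν`, stay in `Ω` up to time `4ρ`. -/
structure IsConeAt (Ω : Set (EuclideanSpace ℝ (Fin N))) (x₀ ν : EuclideanSpace ℝ (Fin N))
    (κ ρ : ℝ) : Prop where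
  norm_eq : ‖ν‖ = 1
  κ_pos : 0 < κ
  κ_le : κ ≤ 1 / 2
  ρ_pos : 0 < ρ
  add_smul_mem : ∀ x ∈ Ω, dist x x₀ < ρ → ∀ y, ‖y - ν‖ ≤ κ → ∀ s ∈ Icc 0 (4 * ρ), x + s • y ∈ Ω

theorem exists_isConeAt_of_mem {Ω : Set (EuclideanSpace ℝ (Fin N))} (hN : 1 ≤ N)
    (hΩ : IsOpen Ω) {x₀ : EuclideanSpace ℝ (Fin N)} (hx₀ : x₀ ∈ Ω) :
    ∃ ν κ ρ, IsConeAt Ω x₀ ν κ ρ := by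
  obtain ⟨R, hR, hball⟩ := Metric.isOpen_iff.1 hΩ x₀ hx₀
  have hν : ‖EuclideanSpace.single (⟨0, hN⟩ : Fin N) (1 : ℝ)‖ = 1 := by simp
  refine ⟨EuclideanSpace.single (⟨0, hN⟩ : Fin N) 1, 1 / 2, R / 10, hν, by norm_num, le_rfl,
    by positivity, ?_⟩
  intro x _ hx y hy s hs
  apply hball
  rw [mem_ball, dist_eq_norm] at *
  have hy2 : ‖y‖ ≤ 3 / 2 := by
    calc ‖y‖ = ‖(y - EuclideanSpace.single (⟨0, hN⟩ : Fin N) (1 : ℝ)) +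
        EuclideanSpace.single (⟨0, hN⟩ : Fin N) (1 : ℝ)‖ := by simp
      _ ≤ _ := norm_add_le _ _
      _ ≤ 3 / 2 := by rw [hν]; linarith
  have h1 : ‖s • y‖ ≤ 4 * (R / 10) * (3 / 2) := by
    rw [norm_smul, Real.norm_of_nonneg hs.1]
    exact mul_le_mul hs.2 hy2 (norm_nonneg _) (by positivity)
  calc ‖x + s • y - x₀‖ = ‖(x - x₀) + s • y‖ := by congr 1; abel
    _ ≤ ‖x - x₀‖ + ‖s • y‖ := norm_add_le _ _
    _ < R := by linarith

/-- Along a direction within `κ` of `ν`, the height over `ν^⊥` grows at rate at least `1 - κ`, while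
the graph function, being locally Lipschitz with constant `K`, grows at rate at most `2Kκ`. For
small `κ` the ray therefore stays above the graph. -/
theorem exists_isConeAt_of_mem_frontier {Ω : Set (EuclideanSpace ℝ (Fin N))}
    (hΩ : HasC2Boundary Ω) {x₀ : EuclideanSpace ℝ (Fin N)} (hx₀ : x₀ ∈ frontier Ω) :
    ∃ ν κ ρ, IsConeAt Ω x₀ ν κ ρ := by
  obtain ⟨ν, γ, r, hν, hγ, hr, hΩr⟩ := hΩ x₀ hx₀
  let π : EuclideanSpace ℝ (Fin N) → EuclideanSpace ℝ (Fin N) := fun x => x - ⟪ν, x⟫ • ν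
  have hπsub : ∀ x y, π (x - y) = π x - π y := fun x y => by
    simp only [π, inner_sub_right, sub_smul]; abel
  have hπsmul : ∀ (s : ℝ) x, π (s • x) = s • π x := fun s x => by
    simp only [π, inner_smul_right, smul_sub, smul_smul]
  have hπν : π ν = 0 := by simp [π, hν]
  have hπle : ∀ x, ‖π x‖ ≤ 2 * ‖x‖ := fun x => by
    calc ‖π x‖ ≤ ‖x‖ + ‖⟪ν, x⟫ • ν‖ := norm_sub_le _ _
      _ ≤ ‖x‖ + ‖x‖ := by
        rw [norm_smul, hν, mul_one]
        have := norm_inner_le_norm (𝕜 := ℝ) ν x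
        rw [hν, one_mul] at this
        gcongr
      _ = 2 * ‖x‖ := by ring
  obtain ⟨K, t, ht, hK⟩ := (hγ.of_le one_le_two).contDiffAt (x := π x₀) |>.exists_lipschitzOnWith
  obtain ⟨R, hR, hRt⟩ := Metric.mem_nhds_iff.1 ht
  -- Chosen so that `2Kκ ≤ 1 - κ`; the factor 2 is the crude bound on the norm of the projection
  -- `π`.
  set κ : ℝ := 1 / (2 * K + 2) with hκ
  have hK0 : (0 : ℝ) ≤ K := K.2
  have hκpos : 0 < κ := by positivity
  have hκle : κ ≤ 1 / 2 := by
    rw [hκ]; apply one_div_le_one_div_of_le <;> linarith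
  have hκK : 2 * K * κ + κ ≤ 1 := by
    rw [hκ, mul_one_div, ← add_div, div_le_one (by positivity)]; linarith
  set ρ : ℝ := min r R / 20 with hρ
  have hρpos : 0 < ρ := by positivity
  have hρr : 20 * ρ ≤ r := by rw [hρ]; linarith [min_le_left r R]
  have hρR : 20 * ρ ≤ R := by rw [hρ]; linarith [min_le_right r R]
  refine ⟨ν, κ, ρ, hν, hκpos, hκle, hρpos, ?_⟩
  intro x hx hxx y hy s hs
  have hs0 := hs.1
  have hy2 : ‖y‖ ≤ 3 / 2 := by
    calc ‖y‖ = ‖(y - ν) + ν‖ := by simp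
      _ ≤ _ := norm_add_le _ _
      _ ≤ 3 / 2 := by rw [hν]; linarith
  have h1 : ‖s • y‖ ≤ 6 * ρ := by
    rw [norm_smul, Real.norm_of_nonneg hs.1]
    calc s * ‖y‖ ≤ 4 * ρ * (3 / 2) := mul_le_mul hs.2 hy2 (norm_nonneg _) (by positivity)
      _ = _ := by ring
  have hdist : dist (x + s • y) x₀ < 8 * ρ := by
    rw [dist_eq_norm] at *
    calc ‖x + s • y - x₀‖ = ‖(x - x₀) + s • y‖ := by congr 1; abel
      _ ≤ ‖x - x₀‖ + ‖s • y‖ := norm_add_le _ _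
      _ < 8 * ρ := by linarith
  have hmemt : ∀ z, dist z x₀ < 8 * ρ → π z ∈ t := fun z hz => by
    apply hRt
    rw [mem_ball, dist_eq_norm, ← hπsub]
    rw [dist_eq_norm] at hz
    linarith [hπle (z - x₀)]
  have hxr := (hΩr x (mem_ball.2 (by linarith))).1 hx
  refine (hΩr _ (mem_ball.2 (by linarith))).2 ?_
  have hlip := hK.dist_le_mul (π (x + s • y)) (hmemt _ hdist) (π x) (hmemt _ (by linarith))
  have hπd : dist (π (x + s • y)) (π x) ≤ 2 * s * κ := by
    rw [dist_eq_norm, ← hπsub, add_sub_cancel_left, hπsmul, norm_smul, Real.norm_of_nonneg hs0]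
    have : ‖π y‖ ≤ 2 * κ := by
      have h := hπle (y - ν)
      rw [hπsub, hπν, sub_zero] at h
      linarith
    nlinarith
  have h2 : γ (π (x + s • y)) - γ (π x) ≤ K * (2 * s * κ) := by
    refine (le_abs_self _).trans ((Real.dist_eq _ _ ▸ hlip).trans ?_)
    gcongr
  have h3 : s * (1 - κ) ≤ s * ⟪ν, y⟫ := by
    gcongr
    have h := neg_le_of_abs_le (abs_real_inner_le_norm ν (y - ν))
    rw [inner_sub_right, real_inner_self_eq_norm_sq, hν] at h
    linarith
  change γ (π (x + s • y)) < ⟪ν, x + s • y⟫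
  change γ (π x) < _ at hxr
  rw [inner_add_right, inner_smul_right]
  nlinarith

theorem exists_isConeAt {Ω : Set (EuclideanSpace ℝ (Fin N))} (hN : 1 ≤ N)
    (hΩ : IsOpen Ω) (hΩ2 : HasC2Boundary Ω) {x₀ : EuclideanSpace ℝ (Fin N)}
    (hx₀ : x₀ ∈ closure Ω) : ∃ ν κ ρ, IsConeAt Ω x₀ ν κ ρ := by
  by_cases h : x₀ ∈ Ω
  · exact exists_isConeAt_of_mem hN hΩ h
  · exact exists_isConeAt_of_mem_frontier hΩ2 (by rw [hΩ.frontier_eq]; exact ⟨hx₀, h⟩)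

/-- A ball is open, hence spans, so a basis can be extracted from it. This supplies `N` independent
directions inside one cone. -/
theorem exists_basis_near (ν : EuclideanSpace ℝ (Fin N)) {κ : ℝ} (hκ : 0 < κ) :
    ∃ b : Basis (Fin N) ℝ (EuclideanSpace ℝ (Fin N)), ∀ i, ‖b i - ν‖ ≤ κ := by
  have hspan : (⊤ : Submodule ℝ (EuclideanSpace ℝ (Fin N))) ≤ Submodule.span ℝ (ball ν κ) := by
    rw [top_le_iff]
    refine Submodule.eq_top_of_nonempty_interior' _ ⟨ν, ?_⟩
    exact mem_interior.2 ⟨ball ν κ, Submodule.subset_span, isOpen_ball, mem_ball_self hκ⟩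
  let b := Basis.ofSpan hspan
  have hb : ∀ i, b i ∈ ball ν κ := fun i => Basis.ofSpan_subset hspan ⟨i, rfl⟩
  have : Fintype _ := FiniteDimensional.fintypeBasisIndex b
  have hc := Module.finrank_eq_card_basis b
  rw [finrank_euclideanSpace_fin] at hc
  refine ⟨b.reindex (Fintype.equivFinOfCardEq hc.symm), fun i => ?_⟩
  rw [Basis.reindex_apply, ← dist_eq_norm]
  exact (mem_ball.1 (hb _)).le

/-! ### The Sobolev inequality for smooth functions on a cone patch -/

section Ray

variable {Ω : Set (EuclideanSpace ℝ (Fin N))} {x₀ ν : EuclideanSpace ℝ (Fin N)} {κ ρ : ℝ}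
  {w : EuclideanSpace ℝ (Fin N) → ℝ}

/-- A function vanishing away from `x₀` is controlled along each ray of the cone by its
derivative inside `Ω`. -/
theorem IsConeAt.enorm_le_lintegral_ray (h : IsConeAt Ω x₀ ν κ ρ) (hw : ContDiff ℝ 1 w)
    (hw0 : ∀ x, ρ ≤ dist x x₀ → w x = 0) {v : EuclideanSpace ℝ (Fin N)} (hv : ‖v - ν‖ ≤ κ)
    {x : EuclideanSpace ℝ (Fin N)} (hx : x ∈ Ω) :
    ‖w x‖ₑ ≤ ∫⁻ t : ℝ, Ω.indicator (fun z => 2 * ‖fderiv ℝ w z‖ₑ) (x + t • v) := by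
  by_cases hxx : ρ ≤ dist x x₀
  · simp [hw0 x hxx]
  push Not at hxx
  have hρ := h.ρ_pos
  have hv1 : 1 / 2 ≤ ‖v‖ := by
    have := norm_sub_norm_le ν (ν - v)
    rw [h.norm_eq, sub_sub_cancel, norm_sub_rev] at this
    linarith [h.κ_le]
  have hv2 : ‖v‖ ≤ 2 := by
    have := norm_sub_norm_le v ν
    rw [h.norm_eq] at this
    linarith [h.κ_le]
  -- Since `‖v‖ ≥ 1/2`, a time `4ρ` moves the point by at least `2ρ`, hence out of the `ρ`-ball
  -- about `x₀`.
  have hend : w (x + (4 * ρ) • v) = 0 := by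
    apply hw0
    have h1 : ‖(4 * ρ) • v‖ ≤ dist (x + (4 * ρ) • v) x₀ + dist x x₀ := by
      rw [dist_eq_norm, dist_eq_norm]
      refine le_trans (le_of_eq ?_) (norm_sub_le (x + (4 * ρ) • v - x₀) (x - x₀))
      congr 1
      abel
    rw [norm_smul, Real.norm_of_nonneg (by positivity)] at h1
    nlinarith
  have hline : ∀ t : ℝ, HasDerivAt (fun s : ℝ => x + s • v) v t := fun t => by
    simpa using ((hasDerivAt_id t).smul_const v).const_add x
  have hder : ∀ t : ℝ, HasDerivAt (fun s : ℝ => w (x + s • v)) (fderiv ℝ w (x + t • v) v) t :=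
    fun t => ((hw.differentiable one_ne_zero _).hasFDerivAt.comp_hasDerivAt t (hline t))
  have hcont : Continuous (fun t : ℝ => fderiv ℝ w (x + t • v) v) :=
    ((hw.continuous_fderiv one_ne_zero).comp (by fun_prop)).clm_apply continuous_const
  have hftc := intervalIntegral.integral_eq_sub_of_hasDerivAt (a := 0) (b := 4 * ρ)
    (fun t _ => hder t) (hcont.intervalIntegrable _ _)
  simp only [hend, zero_smul, add_zero, zero_sub] at hftc
  calc ‖w x‖ₑ = ‖∫ t in (0 : ℝ)..(4 * ρ), fderiv ℝ w (x + t • v) v‖ₑ := by rw [hftc, enorm_neg]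
    _ = ‖∫ t in Ioc (0 : ℝ) (4 * ρ), fderiv ℝ w (x + t • v) v‖ₑ := by
      rw [intervalIntegral.integral_of_le (by positivity)]
    _ ≤ ∫⁻ t in Ioc (0 : ℝ) (4 * ρ), ‖fderiv ℝ w (x + t • v) v‖ₑ :=
      enorm_integral_le_lintegral_enorm _
    _ ≤ ∫⁻ t in Ioc (0 : ℝ) (4 * ρ),
        Ω.indicator (fun z => 2 * ‖fderiv ℝ w z‖ₑ) (x + t • v) := by
      refine setLIntegral_mono' measurableSet_Ioc fun t ht => ?_
      rw [indicator_of_mem (h.add_smul_mem x hx hxx v hv t ⟨ht.1.le, ht.2⟩)]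
      refine (ContinuousLinearMap.le_opENorm _ _).trans ?_
      rw [mul_comm]
      gcongr
      rw [← ofReal_norm]
      exact (ENNReal.ofReal_le_ofReal hv2).trans_eq (ENNReal.ofReal_ofNat 2)
    _ ≤ _ := setLIntegral_le_lintegral _ _

end Ray

/-- The Gagliardo-Nirenberg inequality on a cone patch, in a form that also covers dimension one. -/
theorem IsConeAt.exists_lintegral_rpow_le {Ω : Set (EuclideanSpace ℝ (Fin N))}
    {x₀ ν : EuclideanSpace ℝ (Fin N)} {κ ρ : ℝ} (h : IsConeAt Ω x₀ ν κ ρ) (hN : 1 ≤ N)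
    (hΩ : IsOpen Ω) (hΩf : volume Ω ≠ ⊤) {σ : ℝ} (hσ : 1 < σ)
    (hσN : 2 ≤ N → Real.HolderConjugate N σ) :
    ∃ C : ℝ≥0, ∀ w : EuclideanSpace ℝ (Fin N) → ℝ, ContDiff ℝ 1 w →
      (∀ x, ρ ≤ dist x x₀ → w x = 0) →
      ∫⁻ x in Ω, ‖w x‖ₑ ^ σ ≤ C * (∫⁻ x in Ω, ‖fderiv ℝ w x‖ₑ) ^ σ := by
  obtain ⟨b, hb⟩ := exists_basis_near ν h.κ_pos
  -- In these coordinates, varying the `i`-th one moves along `b i`, a direction of the cone, so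
  -- lines parallel to the axes carry the ray estimate. Lebesgue measure changes only by the
  -- constant factor `c`.
  let e : (Fin N → ℝ) ≃L[ℝ] EuclideanSpace ℝ (Fin N) := b.equivFun.symm.toContinuousLinearEquiv
  have heu : ∀ (y : Fin N → ℝ) i t, e (Function.update y i t) = e y + (t - y i) • b i := by
    intro y i t
    have h1 : Function.update y i t = y + (t - y i) • Pi.single i 1 := by
      ext j
      by_cases hj : j = i
      · subst hj; simp
      · simp [hj]
    rw [h1, map_add, map_smul]
    congr 2
    simp [e, Basis.equivFun_symm_apply, Pi.single_apply]
  let μ : Measure (EuclideanSpace ℝ (Fin N)) := (volume : Measure (Fin N → ℝ)).map e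
  have hemb : MeasurableEmbedding e := e.toHomeomorph.measurableEmbedding
  let c := Measure.addHaarScalarFactor (volume : Measure (EuclideanSpace ℝ (Fin N))) μ
  have hc : 0 < c := Measure.addHaarScalarFactor_pos_of_isAddHaarMeasure ..
  have hvol : (volume : Measure (EuclideanSpace ℝ (Fin N))) = c • μ :=
    Measure.isAddLeftInvariant_eq_smul ..
  have hint : ∀ H : EuclideanSpace ℝ (Fin N) → ℝ≥0∞, ∫⁻ x, H x = c * ∫⁻ y, H (e y) := by
    intro H
    rw [hvol, ENNReal.smul_def, lintegral_smul_measure, hemb.lintegral_map, smul_eq_mul]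
  have hσ0 : 0 ≤ σ := by linarith
  have hray : ∀ w : EuclideanSpace ℝ (Fin N) → ℝ, ContDiff ℝ 1 w →
      (∀ x, ρ ≤ dist x x₀ → w x = 0) → ∀ (y : Fin N → ℝ) (i : Fin N),
      Ω.indicator (fun x => ‖w x‖ₑ) (e y) ≤
        ∫⁻ t, Ω.indicator (fun z => 2 * ‖fderiv ℝ w z‖ₑ) (e (Function.update y i t)) := by
    intro w hw hw0 y i
    by_cases hy : e y ∈ Ω
    · rw [indicator_of_mem hy]
      refine (h.enorm_le_lintegral_ray hw hw0 (hb i) hy).trans_eq ?_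
      simp_rw [heu]
      exact (lintegral_sub_right_eq_self
        (fun t => Ω.indicator (fun z => 2 * ‖fderiv ℝ w z‖ₑ) (e y + t • b i)) (y i)).symm
    · simp [indicator_of_notMem hy]
  have hleft : ∀ w : EuclideanSpace ℝ (Fin N) → ℝ, ∫⁻ x in Ω, ‖w x‖ₑ ^ σ =
      c * ∫⁻ y, (Ω.indicator (fun x => ‖w x‖ₑ) (e y)) ^ σ := by
    intro w
    rw [← lintegral_indicator hΩ.measurableSet, hint]
    congr 2 with y
    by_cases hy : e y ∈ Ω <;> simp [hy, show 0 < σ by linarith]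
  have hright : ∀ w : EuclideanSpace ℝ (Fin N) → ℝ,
      ∫⁻ y, Ω.indicator (fun z => 2 * ‖fderiv ℝ w z‖ₑ) (e y) =
      (c : ℝ≥0∞)⁻¹ * (2 * ∫⁻ x in Ω, ‖fderiv ℝ w x‖ₑ) := by
    intro w
    rw [← lintegral_const_mul' _ _ (by simp), ← lintegral_indicator hΩ.measurableSet, hint,
      ← mul_assoc, ENNReal.inv_mul_cancel (by simpa using hc.ne') (by simp), one_mul]
  have hmeas : ∀ w : EuclideanSpace ℝ (Fin N) → ℝ, ContDiff ℝ 1 w →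
      Measurable (fun y => Ω.indicator (fun z => 2 * ‖fderiv ℝ w z‖ₑ) (e y)) := by
    intro w hw
    have := hw.continuous_fderiv one_ne_zero
    have hm : Measurable (Ω.indicator (fun z => 2 * ‖fderiv ℝ w z‖ₑ)) :=
      Measurable.indicator (by fun_prop) hΩ.measurableSet
    exact hm.comp e.continuous.measurable
  suffices hC : ∃ C : ℝ≥0, ∀ w : EuclideanSpace ℝ (Fin N) → ℝ, ContDiff ℝ 1 w →
      (∀ x, ρ ≤ dist x x₀ → w x = 0) →
      ∫⁻ y, (Ω.indicator (fun x => ‖w x‖ₑ) (e y)) ^ σ ≤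
        C * (∫⁻ y, Ω.indicator (fun z => 2 * ‖fderiv ℝ w z‖ₑ) (e y)) ^ σ by
    obtain ⟨C, hC⟩ := hC
    refine ⟨c * (C * (c⁻¹ * 2) ^ σ), fun w hw hw0 => ?_⟩
    rw [hleft]
    refine (mul_le_mul_right (hC w hw hw0) _).trans_eq ?_
    rw [hright, ← mul_assoc _ (2 : ℝ≥0∞), ENNReal.mul_rpow_of_nonneg _ _ hσ0]
    push_cast
    rw [ENNReal.coe_rpow_of_nonneg _ hσ0]
    push_cast
    rw [ENNReal.coe_inv hc.ne']
    ring
  rcases hN.eq_or_lt with h1 | h2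
  · subst h1
    -- In dimension one the ray estimate is already a sup bound, and any exponent `σ` follows from
    -- the finite volume of `Ω`.
    refine ⟨((c : ℝ≥0∞)⁻¹ * volume Ω).toNNReal, fun w hw hw0 => ?_⟩
    have hfin : (c : ℝ≥0∞)⁻¹ * volume Ω ≠ ⊤ :=
      ENNReal.mul_ne_top (by simpa using hc.ne') hΩf
    rw [ENNReal.coe_toNNReal hfin]
    set I := ∫⁻ y, Ω.indicator (fun z => 2 * ‖fderiv ℝ w z‖ₑ) (e y) with hI
    have hb1 : ∀ y, Ω.indicator (fun x => ‖w x‖ₑ) (e y) ≤ I := by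
      intro y
      refine (hray w hw hw0 y 0).trans_eq ?_
      have hmp := (volume_preserving_funUnique (Fin 1) ℝ).symm
      refine Eq.trans ?_ (hmp.lintegral_comp (hmeas w hw))
      congr 1 with t
      congr 2
      ext j
      rw [Subsingleton.elim j 0]
      simp
    calc ∫⁻ y, (Ω.indicator (fun x => ‖w x‖ₑ) (e y)) ^ σ
        ≤ ∫⁻ y, Ω.indicator (fun _ => I ^ σ) (e y) := by
          refine lintegral_mono fun y => ?_
          by_cases hy : e y ∈ Ω
          · rw [indicator_of_mem hy (fun _ => I ^ σ)]
            gcongr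
            exact hb1 y
          · simp [hy, show 0 < σ by linarith]
      _ = (c : ℝ≥0∞)⁻¹ * ∫⁻ x, Ω.indicator (fun _ => I ^ σ) x := by
          rw [hint, ← mul_assoc, ENNReal.inv_mul_cancel (by simpa using hc.ne') (by simp),
            one_mul]
      _ = _ := by
          rw [lintegral_indicator_const hΩ.measurableSet]; ring
  · have hconj := hσN h2
    refine ⟨1, fun w hw hw0 => ?_⟩
    have h2' : (1 : ℝ) < N := by exact_mod_cast h2
    -- The grid-lines inequality: the `N` ray bounds, each to the power `1/(N-1)`, multiply to the
    -- power `N/(N-1) = σ`.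
    have hg := lintegral_prod_lintegral_pow_le (fun _ : Fin N => (volume : Measure ℝ))
      (p := σ) (by simpa using hconj) (hmeas w hw)
    rw [ENNReal.coe_one, one_mul]
    refine le_trans ?_ hg
    rw [← volume_pi]
    refine lintegral_mono fun y => ?_
    calc (Ω.indicator (fun x => ‖w x‖ₑ) (e y)) ^ σ
        = ∏ _i : Fin N, (Ω.indicator (fun x => ‖w x‖ₑ) (e y)) ^
            ((1 : ℝ) / ((Fintype.card (Fin N) : ℝ) - 1)) := by
          rw [Finset.prod_const, Finset.card_univ, ← ENNReal.rpow_natCast, ← ENNReal.rpow_mul,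
            hconj.conjugate_eq, Fintype.card_fin]
          congr 1
          field_simp
      _ ≤ _ := by
          have : (0 : ℝ) ≤ 1 / ((Fintype.card (Fin N) : ℝ) - 1) := by
            rw [Fintype.card_fin]; apply div_nonneg <;> linarith
          gcongr with i
          exact hray w hw hw0 y i

theorem IsSobolevExponent.two_lt {p : ℝ} (hp : IsSobolevExponent N p) : 2 < p := by
  unfold IsSobolevExponent at hp
  split_ifs at hp with h3
  · have h3' : (3 : ℝ) ≤ N := by exact_mod_cast h3
    rw [hp, lt_div_iff₀ (by linarith)]
    linarith
  · exact hp

/-- The `σ` estimate will be applied to `|w|^γ`, whose `σ`-th power is `|w|^p`. The last inequality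
keeps the factor `|w|^(γ-1)` from the derivative in `L²` as soon as `w` is in `L^p`; for `N ≥ 3` it
is an equality. -/
theorem IsSobolevExponent.exists_factorization {p : ℝ} (hp : IsSobolevExponent N p) :
    ∃ σ γ : ℝ, 1 < σ ∧ (2 ≤ N → Real.HolderConjugate N σ) ∧ 1 < γ ∧ γ * σ = p ∧
      2 * (γ - 1) ≤ p := by
  have h2 := hp.two_lt
  unfold IsSobolevExponent at hp
  split_ifs at hp with h3
  · have h3' : (3 : ℝ) ≤ N := by exact_mod_cast h3
    have hN2 : (0 : ℝ) < N - 2 := by linarith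
    have hN1 : (0 : ℝ) < N - 1 := by linarith
    refine ⟨N / (N - 1), 2 * (N - 1) / (N - 2), ?_, fun _ => ?_, ?_, ?_, ?_⟩
    · rw [lt_div_iff₀ hN1]; linarith
    · exact Real.HolderConjugate.conjExponent (by linarith)
    · rw [lt_div_iff₀ hN2]; linarith
    · rw [hp]; field_simp
    · rw [hp]
      refine le_of_eq ?_
      field_simp
      ring
  · refine ⟨2, p / 2, by norm_num, fun h => ?_, by linarith, by ring, by linarith⟩
    have : N = 2 := by omega
    subst this
    have h := Real.HolderConjugate.conjExponent (p := (2 : ℝ)) (by norm_num)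
    norm_num [Real.conjExponent] at h ⊢
    exact h

/-- The Sobolev inequality `‖w‖_p ≤ C ‖∇w‖₂` on a cone patch. -/
theorem IsConeAt.exists_eLpNorm_le {Ω : Set (EuclideanSpace ℝ (Fin N))}
    {x₀ ν : EuclideanSpace ℝ (Fin N)} {κ ρ : ℝ} (h : IsConeAt Ω x₀ ν κ ρ) (hN : 1 ≤ N)
    (hΩ : IsOpen Ω) (hΩf : volume Ω ≠ ⊤) {p : ℝ} (hp : IsSobolevExponent N p) :
    ∃ C : ℝ≥0, ∀ w : EuclideanSpace ℝ (Fin N) → ℝ, ContDiff ℝ 1 w →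
      (∀ x, ρ ≤ dist x x₀ → w x = 0) →
      ∫⁻ x in Ω, ‖w x‖ₑ ^ p ≤ C * (∫⁻ x in Ω, ‖fderiv ℝ w x‖ₑ ^ (2 : ℝ)) ^ (p / 2) := by
  have hp2 := hp.two_lt
  obtain ⟨σ, γ, hσ, hσN, hγ, hγσ, hγp⟩ := hp.exists_factorization
  obtain ⟨C, hC⟩ := h.exists_lintegral_rpow_le hN hΩ hΩf hσ hσN
  have hσ0 : 0 < σ := by linarith
  have hγ0 : 0 < γ := by linarith
  have hp0 : 0 < p := by linarith
  have hγ1 : 0 < γ - 1 := by linarith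
  set V : ℝ≥0 := ((volume Ω) ^ (1 / (2 * (γ - 1)) - 1 / p)).toNNReal with hV
  have hexp : 0 ≤ 1 / (2 * (γ - 1)) - 1 / p := by
    rw [sub_nonneg]
    exact one_div_le_one_div_of_le (by positivity) hγp
  have hVcoe : (V : ℝ≥0∞) = (volume Ω) ^ (1 / (2 * (γ - 1)) - 1 / p) :=
    ENNReal.coe_toNNReal (ENNReal.rpow_ne_top_of_nonneg hexp hΩf)
  refine ⟨(C ^ (1 / σ) * γ.toNNReal * V ^ (γ - 1)) ^ p, fun w hw hw0 => ?_⟩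
  set A := ∫⁻ x in Ω, ‖w x‖ₑ ^ p with hA
  set B := ∫⁻ x in Ω, ‖fderiv ℝ w x‖ₑ ^ (2 : ℝ) with hB
  set a := eLpNorm' w p (volume.restrict Ω) with ha
  have hAa : a ^ p = A := by
    rw [ha, eLpNorm'_eq_lintegral_enorm, ← ENNReal.rpow_mul, one_div_mul_cancel hp0.ne',
      ENNReal.rpow_one]
  have hwc : Continuous w := hw.continuous
  have hsupp : HasCompactSupport w := by
    refine HasCompactSupport.of_support_subset_isCompact (isCompact_closedBall x₀ ρ) ?_
    intro x hx
    by_contra hx2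
    exact hx (hw0 x (by simpa using (not_le.1 hx2).le))
  have hafin : a ≠ ⊤ := by
    have hm : MemLp w (ENNReal.ofReal p) (volume.restrict Ω) :=
      hwc.memLp_of_hasCompactSupport hsupp
    have := hm.eLpNorm_lt_top.ne
    rwa [eLpNorm_eq_eLpNorm' (by simpa using hp0) (by simp), ENNReal.toReal_ofReal hp0.le] at this
  -- The argument ends by dividing by `a^(γ-1)`, which needs `0 < a < ∞`; finiteness comes from
  -- compact support.
  by_cases ha0 : a = 0
  · rw [← hAa, ha0, ENNReal.zero_rpow_of_pos hp0]
    exact zero_le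
  let v : EuclideanSpace ℝ (Fin N) → ℝ := fun x => ‖w x‖ ^ γ
  have hv : ContDiff ℝ 1 v := hw.norm_rpow hγ
  have hv0 : ∀ x, ρ ≤ dist x x₀ → v x = 0 := fun x hx => by
    simp [v, hw0 x hx, Real.zero_rpow hγ0.ne']
  have hvA : ∫⁻ x in Ω, ‖v x‖ₑ ^ σ = A := by
    rw [hA]
    congr 1 with x
    rw [Real.enorm_rpow_of_nonneg (norm_nonneg _) hγ0.le, ← ENNReal.rpow_mul, hγσ, enorm_norm]
  have hvD : ∫⁻ x in Ω, ‖fderiv ℝ v x‖ₑ ≤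
      ENNReal.ofReal γ * ((a * V) ^ (γ - 1) * B ^ ((1 : ℝ) / 2)) := by
    calc ∫⁻ x in Ω, ‖fderiv ℝ v x‖ₑ
        ≤ ∫⁻ x in Ω, ENNReal.ofReal γ * (‖w x‖ₑ ^ (γ - 1) * ‖fderiv ℝ w x‖ₑ) := by
          refine lintegral_mono fun x => ?_
          have hγ' : (1 : ℝ≥0) < γ.toNNReal := by simpa using hγ
          have := enorm_fderiv_norm_rpow_le (hw.differentiable one_ne_zero) (x := x) hγ'
          rw [Real.coe_toNNReal _ hγ0.le] at this
          rw [← mul_assoc]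
          exact this
      _ = ENNReal.ofReal γ * ∫⁻ x in Ω, (‖w x‖ₑ ^ (γ - 1) * ‖fderiv ℝ w x‖ₑ) :=
          lintegral_const_mul' _ _ ENNReal.ofReal_ne_top
      _ ≤ ENNReal.ofReal γ * ((∫⁻ x in Ω, (‖w x‖ₑ ^ (γ - 1)) ^ (2 : ℝ)) ^ ((1 : ℝ) / 2) *
            B ^ ((1 : ℝ) / 2)) := by
          have hfc := hw.continuous_fderiv one_ne_zero
          gcongr
          refine ENNReal.lintegral_mul_le_Lp_mul_Lq _ Real.HolderConjugate.two_two ?_ ?_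
          · exact (hwc.enorm.measurable.pow_const _).aemeasurable
          · exact hfc.enorm.measurable.aemeasurable
      _ ≤ _ := by
          gcongr
          have h1 := eLpNorm'_le_eLpNorm'_mul_rpow_measure_univ (μ := volume.restrict Ω)
            (show 0 < 2 * (γ - 1) by positivity) hγp hwc.aestronglyMeasurable
          rw [Measure.restrict_apply_univ, ← hVcoe, ← ha] at h1
          refine le_trans (le_of_eq ?_) (ENNReal.rpow_le_rpow h1 hγ1.le)
          rw [eLpNorm'_eq_lintegral_enorm, ← ENNReal.rpow_mul]
          congr 1
          · congr 1 with x
            rw [← ENNReal.rpow_mul, mul_comm]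
          · field_simp
  have h1 := hC v hv hv0
  rw [hvA, ← hAa] at h1
  have h2 : a ^ p ≤ C * (ENNReal.ofReal γ * ((a * V) ^ (γ - 1) * B ^ ((1 : ℝ) / 2))) ^ σ :=
    h1.trans (by gcongr)
  -- The `σ`-th root turns `a^p` into `a^γ = a · a^(γ-1)`, and the second factor cancels against the
  -- right-hand side.
  have h3 := ENNReal.rpow_le_rpow h2 (show 0 ≤ 1 / σ by positivity)
  rw [ENNReal.mul_rpow_of_nonneg _ _ (by positivity), ← ENNReal.rpow_mul, ← ENNReal.rpow_mul,
    mul_one_div_cancel hσ0.ne', ENNReal.rpow_one, ENNReal.mul_rpow_of_nonneg _ _ hγ1.le,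
    show p * (1 / σ) = 1 + (γ - 1) by rw [← hγσ]; field_simp; ring,
    ENNReal.rpow_add _ _ ha0 hafin, ENNReal.rpow_one] at h3
  have ha1 : a ^ (γ - 1) ≠ 0 := (ENNReal.rpow_pos (pos_iff_ne_zero.2 ha0) hafin).ne'
  have ha2 : a ^ (γ - 1) ≠ ⊤ := ENNReal.rpow_ne_top_of_nonneg hγ1.le hafin
  have h4 : a ≤ ((C ^ (1 / σ) * γ.toNNReal * V ^ (γ - 1) : ℝ≥0) : ℝ≥0∞) * B ^ ((1 : ℝ) / 2) := by
    rw [← ENNReal.mul_le_mul_iff_left ha1 ha2]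
    refine h3.trans_eq ?_
    push_cast
    rw [ENNReal.coe_rpow_of_nonneg _ (by positivity), ENNReal.coe_rpow_of_nonneg _ hγ1.le]
    simp only [ENNReal.ofReal]
    ring
  rw [← hAa]
  refine (ENNReal.rpow_le_rpow h4 hp0.le).trans_eq ?_
  rw [ENNReal.mul_rpow_of_nonneg _ _ hp0.le, ← ENNReal.rpow_mul,
    ENNReal.coe_rpow_of_nonneg _ hp0.le]
  congr 2
  ring

/-! ### Mollification into the cone -/

/-- Young's inequality `‖h ⋆ k‖₂ ≤ ‖h‖₂` for a kernel of mass one. -/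
theorem lintegral_convolution_sq_le {h k : EuclideanSpace ℝ (Fin N) → ℝ≥0∞}
    (hh : AEMeasurable h) (hk : Measurable k) (hk1 : ∫⁻ x, k x = 1) :
    ∫⁻ x, (∫⁻ y, h y * k (x - y)) ^ (2 : ℝ) ≤ ∫⁻ y, h y ^ (2 : ℝ) := by
  have hk1' : ∀ x, ∫⁻ y, k (x - y) = 1 := fun x => by
    rw [lintegral_sub_left_eq_self (fun y => k y) x, hk1]
  calc ∫⁻ x, (∫⁻ y, h y * k (x - y)) ^ (2 : ℝ)
      ≤ ∫⁻ x, ∫⁻ y, h y ^ (2 : ℝ) * k (x - y) := by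
        refine lintegral_mono fun x => ?_
        have hkm : Measurable fun y => k (x - y) := hk.comp (measurable_const.sub measurable_id)
        -- Cauchy-Schwarz after splitting the kernel as `k^(1/2) · k^(1/2)`; the second factor
        -- contributes the mass one.
        have hH := ENNReal.lintegral_mul_le_Lp_mul_Lq volume Real.HolderConjugate.two_two
          (f := fun y => h y * k (x - y) ^ ((1 : ℝ) / 2)) (g := fun y => k (x - y) ^ ((1 : ℝ) / 2))
          (hh.mul (hkm.pow_const _).aemeasurable) (hkm.pow_const _).aemeasurable
        have e1 : ∀ y, k (x - y) ^ ((1 : ℝ) / 2) * k (x - y) ^ ((1 : ℝ) / 2) = k (x - y) := by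
          intro y
          rw [← ENNReal.rpow_add_of_nonneg _ _ (by norm_num) (by norm_num)]
          norm_num
        have e2 : ∀ y, (k (x - y) ^ ((1 : ℝ) / 2)) ^ (2 : ℝ) = k (x - y) := by
          intro y
          rw [← ENNReal.rpow_mul]
          norm_num
        simp only [Pi.mul_apply, mul_assoc, e1, e2, hk1', ENNReal.one_rpow, mul_one,
          ENNReal.mul_rpow_of_nonneg _ _ (zero_le_two (α := ℝ))] at hH
        refine (ENNReal.rpow_le_rpow hH zero_le_two).trans_eq ?_
        rw [← ENNReal.rpow_mul]
        norm_num
    _ = ∫⁻ y, ∫⁻ x, h y ^ (2 : ℝ) * k (x - y) := by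
        refine lintegral_lintegral_swap ?_
        refine AEMeasurable.mul ?_ ?_
        · exact (hh.pow_const 2).comp_snd
        · exact (hk.comp (measurable_fst.sub measurable_snd)).aemeasurable
    _ = ∫⁻ y, h y ^ (2 : ℝ) := by
        refine lintegral_congr fun y => ?_
        have hkm : Measurable fun x => k (x - y) := hk.comp (measurable_id.sub measurable_const)
        rw [lintegral_const_mul _ hkm,
          lintegral_sub_right_eq_self (fun x => k x) y, hk1, mul_one]

section Mollify

variable {Ω : Set (EuclideanSpace ℝ (Fin N))} {u : EuclideanSpace ℝ (Fin N) → ℝ}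
  {g : EuclideanSpace ℝ (Fin N) → EuclideanSpace ℝ (Fin N)}

theorem enorm_convolution_le {φ : EuclideanSpace ℝ (Fin N) → ℝ} (x : EuclideanSpace ℝ (Fin N)) :
    ‖(Ω.indicator u ⋆[ContinuousLinearMap.lsmul ℝ ℝ] φ) x‖ₑ ≤
      ∫⁻ y, Ω.indicator (fun y => ‖u y‖ₑ) y * ‖φ (x - y)‖ₑ := by
  rw [convolution_def]
  refine (enorm_integral_le_lintegral_enorm _).trans_eq (lintegral_congr fun y => ?_)
  by_cases hy : y ∈ Ω <;> simp [hy, enorm_mul]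

/-- When `x - supp φ` lies in `Ω`, the function `y ↦ φ (x - y)` is a test function on `Ω`, so the
derivative moves from the kernel to `u` and the jump of the zero extension across the boundary is
not seen. -/
theorem enorm_fderiv_convolution_le (hΩ : IsOpen Ω) (hu : IntegrableOn u Ω)
    (hug : HasWeakGradient Ω u g) {φ : EuclideanSpace ℝ (Fin N) → ℝ} (hφ : ContDiff ℝ ∞ φ)
    (hφc : HasCompactSupport φ) {x : EuclideanSpace ℝ (Fin N)}
    (hx : ∀ z ∈ tsupport φ, x - z ∈ Ω) :
    ‖fderiv ℝ (Ω.indicator u ⋆[ContinuousLinearMap.lsmul ℝ ℝ] φ) x‖ₑ ≤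
      ∫⁻ y, Ω.indicator (fun y => ‖g y‖ₑ) y * ‖φ (x - y)‖ₑ := by
  have hloc : LocallyIntegrable (Ω.indicator u) volume :=
    ((integrable_indicator_iff hΩ.measurableSet).2 hu).locallyIntegrable
  have hder := hφc.hasFDerivAt_convolution_right (ContinuousLinearMap.lsmul ℝ ℝ) hloc
    (hφ.of_le (by simp)) x
  have htest : IsTestFunction Ω (fun y => φ (x - y)) := by
    refine ⟨hφ.comp (contDiff_const.sub contDiff_id), ?_, ?_⟩
    · exact hφc.comp_homeomorph (Homeomorph.subLeft x)
    · intro y hy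
      have h1 : x - y ∈ tsupport φ := by
        have := tsupport_comp_subset_preimage φ (f := fun y => x - y) (by fun_prop) hy
        exact this
      simpa using hx _ h1
  have hval : ∀ v, fderiv ℝ (Ω.indicator u ⋆[ContinuousLinearMap.lsmul ℝ ℝ] φ) x v =
      ∫ y in Ω, ⟪g y, v⟫ * φ (x - y) := by
    intro v
    rw [hder.fderiv, convolution_precompR_apply _ hloc (hφc.fderiv (𝕜 := ℝ))
      (hφ.continuous_fderiv (by simp)), convolution_def]
    have h1 := hug _ htest v
    rw [← neg_eq_iff_eq_neg] at h1
    rw [← h1, ← integral_neg, ← integral_indicator hΩ.measurableSet]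
    congr 1 with y
    have h2 : fderiv ℝ (fun y => φ (x - y)) y = -fderiv ℝ φ (x - y) := by
      have h3 : HasFDerivAt (fun y => x - y)
          (-ContinuousLinearMap.id ℝ (EuclideanSpace ℝ (Fin N))) y :=
        (hasFDerivAt_id y).const_sub x
      have h4 : HasFDerivAt (fun y => φ (x - y)) _ y :=
        ((hφ.differentiable (by simp) (x - y)).hasFDerivAt).comp y h3
      rw [h4.fderiv]
      ext; simp
    by_cases hy : y ∈ Ω <;> simp [hy, h2]
  rw [← ofReal_norm]
  set I := ∫⁻ y, Ω.indicator (fun y => ‖g y‖ₑ) y * ‖φ (x - y)‖ₑ with hI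
  by_cases hIt : I = ⊤
  · rw [hIt]; exact le_top
  rw [ENNReal.ofReal_le_iff_le_toReal hIt]
  refine ContinuousLinearMap.opNorm_le_bound _ ENNReal.toReal_nonneg fun v => ?_
  rw [hval v]
  have h5 : ‖∫ y in Ω, ⟪g y, v⟫ * φ (x - y)‖ₑ ≤ I * ‖v‖ₑ := by
    refine (enorm_integral_le_lintegral_enorm _).trans ?_
    rw [hI, ← lintegral_mul_const' _ _ (by simp), ← lintegral_indicator hΩ.measurableSet]
    refine lintegral_mono fun y => ?_
    by_cases hy : y ∈ Ω
    · simp only [indicator_of_mem hy, enorm_mul]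
      rw [mul_right_comm]
      gcongr
      rw [← ofReal_norm, ← ofReal_norm, ← ofReal_norm, ← ENNReal.ofReal_mul (norm_nonneg _)]
      exact ENNReal.ofReal_le_ofReal (norm_inner_le_norm _ _)
    · simp [hy]
  have h6 := ENNReal.toReal_mono (ENNReal.mul_ne_top hIt (by simp)) h5
  rwa [ENNReal.toReal_mul, toReal_enorm, toReal_enorm] at h6

/-- Mollification with kernels concentrated on the side of the cone: the bump function is centred
at `-τ ν` and has radius `κ τ`. -/
noncomputable def coneBump (ν : EuclideanSpace ℝ (Fin N)) {κ τ : ℝ} (hκ : 0 < κ) (hτ : 0 < τ) :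
    ContDiffBump (-(τ • ν)) where
  rIn := κ * τ / 2
  rOut := κ * τ
  rIn_pos := by positivity
  rIn_lt_rOut := half_lt_self (by positivity)

theorem ae_tendsto_convolution_coneBump {h : EuclideanSpace ℝ (Fin N) → ℝ}
    (hh : LocallyIntegrable h volume)
    {ν : EuclideanSpace ℝ (Fin N)} (hν : ‖ν‖ = 1) {κ : ℝ} (hκ : 0 < κ) {τ : ℕ → ℝ}
    (hτ : ∀ n, 0 < τ n) (hτ0 : Tendsto τ atTop (𝓝 0)) :
    ∀ᵐ x, Tendsto (fun n => (h ⋆[ContinuousLinearMap.lsmul ℝ ℝ]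
      ((coneBump ν hκ (hτ n)).normed volume)) x) atTop (𝓝 (h x)) := by
  -- Lebesgue differentiation along balls not centred at `x`: the ball about `x + τ ν` has radius `κ
  -- τ`, and its dilation by `1/κ` reaches `x`.
  filter_upwards [IsUnifLocDoublingMeasure.ae_tendsto_average_norm_sub volume hh (1 / κ)]
    with x hx
  have hδ : Tendsto (fun n => κ * τ n) atTop (𝓝[>] 0) := by
    refine tendsto_nhdsWithin_iff.2 ⟨by simpa using hτ0.const_mul κ, ?_⟩
    exact Eventually.of_forall fun n => mul_pos hκ (hτ n)
  have hx2 := hx (fun n => x + τ n • ν) (fun n => κ * τ n) hδ (Eventually.of_forall fun n => by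
    rw [mem_closedBall, dist_eq_norm, sub_add_cancel_left, norm_neg, norm_smul, hν,
      Real.norm_of_nonneg (hτ n).le]
    apply le_of_eq
    field_simp)
  have hlim := tendsto_integral_smul_of_tendsto_average_norm_sub (μ := volume)
    (g := fun n y => (coneBump ν hκ (hτ n)).normed volume (x - y))
    (2 ^ (finrank ℝ (EuclideanSpace ℝ (Fin N)))) hx2 ?_ ?_ ?_ ?_
  · refine hlim.congr fun n => ?_
    rw [convolution_def]
    congr 1 with y
    simp [mul_comm]
  · exact Eventually.of_forall fun n => hh.integrableOn_isCompact (isCompact_closedBall _ _)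
  · refine tendsto_const_nhds.congr fun n => ?_
    rw [integral_sub_left_eq_self, ContDiffBump.integral_normed]
  · refine Eventually.of_forall fun n y hy => ?_
    have h1 : x - y ∈ Function.support ((coneBump ν hκ (hτ n)).normed volume) := hy
    rw [ContDiffBump.support_normed_eq, mem_ball, dist_eq_norm] at h1
    rw [mem_closedBall, dist_eq_norm, norm_sub_rev]
    refine le_trans (le_of_eq ?_) h1.le
    congr 1
    abel
  · refine Eventually.of_forall fun n y => ?_
    rw [abs_of_nonneg (ContDiffBump.nonneg_normed _ _)]
    -- The outer radius is twice the inner one, so the kernel is at most `2^N` over the volume of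
    -- its ball, uniformly in `n`.
    have := (coneBump ν hκ (hτ n)).normed_le_div_measure_closedBall_rOut volume 2
      (by simp only [coneBump]; linarith) (x - y)
    rw [Measure.addHaar_real_closedBall_center] at this ⊢
    exact this

end Mollify

/-! ### The Sobolev embedding of `H¹(Ω)` -/

section Sobolev

variable {Ω : Set (EuclideanSpace ℝ (Fin N))}

theorem H1.norm_sq_eq (u : H1 Ω) : ‖u‖ ^ 2 = ‖H1.toL2 u‖ ^ 2 + ‖H1.grad u‖ ^ 2 :=
  WithLp.prod_norm_sq_eq_of_L2 (u : WithLp 2 (L2 Ω × L2Vec Ω))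

theorem H1.norm_toL2_le (u : H1 Ω) : ‖H1.toL2 u‖ ≤ ‖u‖ :=
  abs_le_of_sq_le_sq' (by nlinarith [H1.norm_sq_eq u, sq_nonneg ‖H1.grad u‖]) (norm_nonneg _) |>.2

theorem H1.norm_grad_le (u : H1 Ω) : ‖H1.grad u‖ ≤ ‖u‖ :=
  abs_le_of_sq_le_sq' (by nlinarith [H1.norm_sq_eq u, sq_nonneg ‖H1.toL2 u‖]) (norm_nonneg _) |>.2

theorem lintegral_enorm_sq_eq {F : Type*} [NormedAddCommGroup F]
    (h : Lp F 2 (volume.restrict Ω)) : ∫⁻ x in Ω, ‖h x‖ₑ ^ (2 : ℝ) = ‖h‖ₑ ^ (2 : ℝ) := by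
  rw [Lp.enorm_def, eLpNorm_eq_lintegral_rpow_enorm_toReal (by simp) (by simp),
    ← ENNReal.rpow_mul]
  simp

theorem H1.hasWeakGradient (u : H1 Ω) : HasWeakGradient Ω (H1.toL2 u) (H1.grad u) := u.2

theorem H1.lintegral_toL2_sq_le (u : H1 Ω) :
    ∫⁻ x in Ω, ‖H1.toL2 u x‖ₑ ^ (2 : ℝ) ≤ ‖u‖ₑ ^ (2 : ℝ) := by
  rw [lintegral_enorm_sq_eq]
  gcongr
  rw [← ofReal_norm, ← ofReal_norm]
  exact ENNReal.ofReal_le_ofReal (H1.norm_toL2_le u)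

theorem H1.lintegral_grad_sq_le (u : H1 Ω) :
    ∫⁻ x in Ω, ‖H1.grad u x‖ₑ ^ (2 : ℝ) ≤ ‖u‖ₑ ^ (2 : ℝ) := by
  rw [lintegral_enorm_sq_eq]
  gcongr
  rw [← ofReal_norm, ← ofReal_norm]
  exact ENNReal.ofReal_le_ofReal (H1.norm_grad_le u)

theorem lintegral_indicator_convolution_sq_le (hΩ : IsOpen Ω) {F : Type*} [NormedAddCommGroup F]
    (h : Lp F 2 (volume.restrict Ω)) {z : EuclideanSpace ℝ (Fin N)} (φ : ContDiffBump z) :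
    ∫⁻ x in Ω, (∫⁻ y, Ω.indicator (fun y => ‖h y‖ₑ) y * ‖φ.normed volume (x - y)‖ₑ) ^ (2 : ℝ) ≤
      ∫⁻ x in Ω, ‖h x‖ₑ ^ (2 : ℝ) := by
  refine (setLIntegral_le_lintegral _ _).trans ?_
  refine (lintegral_convolution_sq_le (k := fun y => ‖φ.normed volume y‖ₑ) ?_ ?_ ?_).trans_eq ?_
  · exact (aemeasurable_indicator_iff hΩ.measurableSet).2 (Lp.aestronglyMeasurable h).enorm
  · exact φ.continuous_normed.enorm.measurable
  · rw [← ofReal_integral_norm_eq_lintegral_enorm φ.integrable_normed]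
    simp_rw [Real.norm_of_nonneg (φ.nonneg_normed _)]
    rw [φ.integral_normed, ENNReal.ofReal_one]
  · rw [← lintegral_indicator hΩ.measurableSet]
    refine lintegral_congr fun x => ?_
    by_cases hx : x ∈ Ω <;> simp [hx]

/-- Mollifying `u` into the cone and cutting off near `x₀` gives smooth functions whose gradients
are bounded in `L²(Ω)` by `‖u‖`, uniformly in the scale. The smooth inequality applies to them, and
Fatou's lemma passes to the limit where the cutoff is one. -/
theorem IsConeAt.exists_lintegral_ball_le {x₀ ν : EuclideanSpace ℝ (Fin N)} {κ ρ : ℝ}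
    (h : IsConeAt Ω x₀ ν κ ρ) (hN : 1 ≤ N) (hΩ : IsOpen Ω) (hΩf : volume Ω ≠ ⊤) {p : ℝ}
    (hp : IsSobolevExponent N p) :
    ∃ C : ℝ≥0, ∀ u : H1 Ω,
      ∫⁻ x in Ω ∩ ball x₀ (ρ / 2), ‖H1.toL2 u x‖ₑ ^ p ≤ C * ‖u‖ₑ ^ p := by
  have hρ := h.ρ_pos
  have hp0 : 0 < p := by linarith [hp.two_lt]
  have : IsFiniteMeasure (volume.restrict Ω) := ⟨by simpa using hΩf.lt_top⟩
  obtain ⟨C, hC⟩ := h.exists_eLpNorm_le hN hΩ hΩf hp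
  let χ : ContDiffBump x₀ := ⟨ρ / 2, ρ, by positivity, half_lt_self hρ⟩
  obtain ⟨K, hK⟩ := (χ.contDiff.continuous_fderiv (n := 1) one_ne_zero).bounded_above_of_compact_support
    (χ.hasCompactSupport.fderiv (𝕜 := ℝ))
  have hKe : ∀ x, ‖fderiv ℝ χ x‖ₑ ≤ ENNReal.ofReal K := fun x => by
    rw [← ofReal_norm]; exact ENNReal.ofReal_le_ofReal (hK x)
  refine ⟨C * (2 * 1 + 2 * K.toNNReal ^ 2) ^ (p / 2), fun u => ?_⟩
  have huint : IntegrableOn (H1.toL2 u) Ω := (Lp.memLp (H1.toL2 u)).integrable one_le_two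
  have hloc : LocallyIntegrable (Ω.indicator (H1.toL2 u)) volume :=
    ((integrable_indicator_iff hΩ.measurableSet).2 huint).locallyIntegrable
  -- The scales start at `4ρ`, the length of the cone, so the shifted kernels only look at points of
  -- `Ω`.
  let τ : ℕ → ℝ := fun n => 4 * ρ / (n + 1)
  have hτ : ∀ n, 0 < τ n := fun n => by positivity
  have hτle : ∀ n, τ n ≤ 4 * ρ := fun n => by
    apply div_le_self (by positivity)
    linarith [n.cast_nonneg (α := ℝ)]
  have hτ0 : Tendsto τ atTop (𝓝 0) := tendsto_const_div_atTop_nhds_zero_nat (4 * ρ) |>.comp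
    (tendsto_add_atTop_nat 1) |>.congr fun n => by simp [τ]
  let φ := fun n => coneBump ν h.κ_pos (hτ n)
  let U := fun n => Ω.indicator (H1.toL2 u) ⋆[ContinuousLinearMap.lsmul ℝ ℝ] (φ n).normed volume
  let w := fun n x => χ x * U n x
  have hU : ∀ n, ContDiff ℝ 1 (U n) := fun n =>
    ((φ n).hasCompactSupport_normed).contDiff_convolution_right (n := 1) _ hloc
      ((φ n).contDiff_normed)
  have hw : ∀ n, ContDiff ℝ 1 (w n) := fun n => χ.contDiff.mul (hU n)
  have hw0 : ∀ n x, ρ ≤ dist x x₀ → w n x = 0 := fun n x hx => by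
    simp only [w, χ.zero_of_le_dist hx, zero_mul]
  let G := fun n x => ∫⁻ y, Ω.indicator (fun y => ‖H1.grad u y‖ₑ) y *
    ‖(φ n).normed volume (x - y)‖ₑ
  let W := fun n x => ∫⁻ y, Ω.indicator (fun y => ‖H1.toL2 u y‖ₑ) y *
    ‖(φ n).normed volume (x - y)‖ₑ
  have hfd : ∀ n, ∀ x ∈ Ω, ‖fderiv ℝ (w n) x‖ₑ ≤ G n x + ENNReal.ofReal K * W n x := by
    intro n x hx
    have h1 : fderiv ℝ (w n) x = χ x • fderiv ℝ (U n) x + U n x • fderiv ℝ χ x :=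
      fderiv_fun_mul (χ.contDiff.differentiable (n := 1) one_ne_zero x)
        ((hU n).differentiable one_ne_zero x)
    rw [h1]
    refine (enorm_add_le (χ x • fderiv ℝ (U n) x) (U n x • fderiv ℝ χ x)).trans ?_
    rw [enorm_smul, enorm_smul, mul_comm ‖U n x‖ₑ]
    refine add_le_add ?_ (mul_le_mul' (hKe x) (enorm_convolution_le x))
    by_cases hxx : ρ ≤ dist x x₀
    · simp [χ.zero_of_le_dist hxx]
    · have h2 : ‖χ x‖ₑ ≤ 1 := by
        rw [← ofReal_norm, Real.norm_of_nonneg χ.nonneg, ← ENNReal.ofReal_one]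
        exact ENNReal.ofReal_le_ofReal χ.le_one
      refine (mul_le_of_le_one_left' h2).trans ?_
      refine enorm_fderiv_convolution_le hΩ huint (H1.hasWeakGradient u) (φ n).contDiff_normed
        (φ n).hasCompactSupport_normed fun z hz => ?_
      rw [ContDiffBump.tsupport_normed_eq, mem_closedBall, dist_eq_norm] at hz
      -- A point `z` of the support is within `κ τ` of `-τ ν`, so `x - z` is reached at time `τ`
      -- along the cone direction `-z/τ`.
      have h3 := h.add_smul_mem x hx (not_le.1 hxx) (-(1 / τ n) • z) ?_ (τ n)
        ⟨(hτ n).le, hτle n⟩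
      · rwa [smul_smul, mul_neg, mul_one_div_cancel (hτ n).ne', neg_one_smul,
          ← sub_eq_add_neg] at h3
      · have h4 : -(1 / τ n) • z - ν = (-(1 / τ n)) • (z - -(τ n • ν)) := by
          rw [smul_sub, smul_neg, smul_smul, neg_mul, one_div_mul_cancel (hτ n).ne']
          simp
        rw [h4, norm_smul, norm_neg, Real.norm_of_nonneg (by have := hτ n; positivity)]
        have h5 : (φ n).rOut = κ * τ n := rfl
        rw [h5] at hz
        calc 1 / τ n * ‖z - -(τ n • ν)‖ ≤ 1 / τ n * (κ * τ n) := by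
              have := hτ n
              gcongr
          _ = κ := by have := (hτ n).ne'; field_simp
  have hB : ∀ n, ∫⁻ x in Ω, ‖fderiv ℝ (w n) x‖ₑ ^ (2 : ℝ) ≤
      (2 * 1 + 2 * K.toNNReal ^ 2 : ℝ≥0) * ‖u‖ₑ ^ (2 : ℝ) := by
    intro n
    have hk : Measurable fun y => ‖(φ n).normed volume y‖ₑ :=
      (φ n).continuous_normed.enorm.measurable
    have hGm : AEMeasurable (G n) volume := by
      refine AEMeasurable.lintegral_prod_right' (f := fun q : EuclideanSpace ℝ (Fin N) ×
        EuclideanSpace ℝ (Fin N) => Ω.indicator (fun y => ‖H1.grad u y‖ₑ) q.2 *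
          ‖(φ n).normed volume (q.1 - q.2)‖ₑ) ?_
      refine AEMeasurable.mul ?_ (hk.comp (measurable_fst.sub measurable_snd)).aemeasurable
      exact AEMeasurable.comp_snd ((aemeasurable_indicator_iff hΩ.measurableSet).2
        (Lp.aestronglyMeasurable (H1.grad u)).enorm)
    calc ∫⁻ x in Ω, ‖fderiv ℝ (w n) x‖ₑ ^ (2 : ℝ)
        ≤ ∫⁻ x in Ω, (2 * G n x ^ (2 : ℝ) +
            2 * ENNReal.ofReal K ^ 2 * W n x ^ (2 : ℝ)) := by
          refine setLIntegral_mono' hΩ.measurableSet fun x hx => ?_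
          refine (ENNReal.rpow_le_rpow (hfd n x hx) zero_le_two).trans ?_
          refine (ENNReal.rpow_add_le_mul_rpow_add_rpow _ _ one_le_two).trans_eq ?_
          rw [ENNReal.mul_rpow_of_nonneg _ _ zero_le_two]
          norm_num
          ring
      _ = 2 * (∫⁻ x in Ω, G n x ^ (2 : ℝ)) +
            2 * ENNReal.ofReal K ^ 2 * ∫⁻ x in Ω, W n x ^ (2 : ℝ) := by
          rw [lintegral_add_left' ((hGm.restrict.pow_const 2).const_mul 2),
            lintegral_const_mul' _ _ (by simp),
            lintegral_const_mul' _ _ (ENNReal.mul_ne_top (by simp) (by simp))]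
      _ ≤ 2 * ‖u‖ₑ ^ (2 : ℝ) + 2 * ENNReal.ofReal K ^ 2 * ‖u‖ₑ ^ (2 : ℝ) := by
          gcongr
          · exact (lintegral_indicator_convolution_sq_le hΩ _ _).trans (H1.lintegral_grad_sq_le u)
          · exact (lintegral_indicator_convolution_sq_le hΩ _ _).trans (H1.lintegral_toL2_sq_le u)
      _ = _ := by
          push_cast
          rw [ENNReal.ofReal]
          ring
  have hbound : ∀ n, ∫⁻ x in Ω ∩ ball x₀ (ρ / 2), ‖w n x‖ₑ ^ p ≤
      (C * (2 * 1 + 2 * K.toNNReal ^ 2) ^ (p / 2) : ℝ≥0) * ‖u‖ₑ ^ p := by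
    intro n
    refine (lintegral_mono_set inter_subset_left).trans ((hC (w n) (hw n) (hw0 n)).trans ?_)
    have h1 := ENNReal.rpow_le_rpow (hB n) (show 0 ≤ p / 2 by positivity)
    rw [ENNReal.mul_rpow_of_nonneg _ _ (by positivity), ← ENNReal.rpow_mul,
      mul_div_cancel₀ _ two_ne_zero] at h1
    rw [ENNReal.coe_mul, ENNReal.coe_rpow_of_nonneg _ (by positivity), mul_assoc]
    gcongr
  have hae := ae_tendsto_convolution_coneBump hloc h.norm_eq h.κ_pos hτ hτ0
  calc ∫⁻ x in Ω ∩ ball x₀ (ρ / 2), ‖H1.toL2 u x‖ₑ ^ p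
      = ∫⁻ x in Ω ∩ ball x₀ (ρ / 2), liminf (fun n => ‖w n x‖ₑ ^ p) atTop := by
        refine setLIntegral_congr_fun_ae (hΩ.inter isOpen_ball).measurableSet ?_
        filter_upwards [hae] with x hx hxΩ
        have h1 : χ x = 1 := χ.one_of_mem_closedBall (ball_subset_closedBall hxΩ.2)
        rw [indicator_of_mem hxΩ.1] at hx
        have h2 : Tendsto (fun n => ‖w n x‖ₑ ^ p) atTop (𝓝 (‖H1.toL2 u x‖ₑ ^ p)) := by
          have h3 : Tendsto (fun n => w n x) atTop (𝓝 (H1.toL2 u x)) := by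
            simpa only [w, h1, one_mul] using hx
          exact (ENNReal.continuous_rpow_const.tendsto _).comp h3.enorm
        exact h2.liminf_eq.symm
    _ ≤ liminf (fun n => ∫⁻ x in Ω ∩ ball x₀ (ρ / 2), ‖w n x‖ₑ ^ p) atTop :=
        lintegral_liminf_le fun n => (hw n).continuous.enorm.measurable.pow_const _
    _ ≤ _ := liminf_le_of_frequently_le' (Frequently.of_forall hbound)

/-- The Sobolev embedding `H¹(Ω) ⊂ L^p(Ω)` on a bounded open set with `C²` boundary. -/
theorem exists_sobolev_constant (hN : 1 ≤ N) (hΩ : IsOpen Ω) (hΩb : Bornology.IsBounded Ω)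
    (hΩ2 : HasC2Boundary Ω) {p : ℝ} (hp : IsSobolevExponent N p) :
    ∃ S : ℝ≥0, ∀ u : H1 Ω, ∫⁻ x in Ω, ‖H1.toL2 u x‖ₑ ^ p ≤ S * ‖u‖ₑ ^ p := by
  have hcomp : IsCompact (closure Ω) := hΩb.isCompact_closure
  have hΩf : volume Ω ≠ ⊤ := hΩb.measure_lt_top.ne
  have hloc : ∀ x₀ ∈ closure Ω, ∃ r > 0, ∃ C : ℝ≥0, ∀ u : H1 Ω,
      ∫⁻ x in Ω ∩ ball x₀ r, ‖H1.toL2 u x‖ₑ ^ p ≤ C * ‖u‖ₑ ^ p := by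
    intro x₀ hx₀
    obtain ⟨ν, κ, ρ, h⟩ := exists_isConeAt hN hΩ hΩ2 hx₀
    exact ⟨ρ / 2, half_pos h.ρ_pos, h.exists_lintegral_ball_le hN hΩ hΩf hp⟩
  choose! r hr C hC using hloc
  obtain ⟨t, ht, hcover⟩ := hcomp.elim_nhds_subcover (fun x => ball x (r x))
    fun x hx => ball_mem_nhds x (hr x hx)
  refine ⟨∑ x ∈ t, C x, fun u => ?_⟩
  have hsub : Ω ⊆ ⋃ z : t, Ω ∩ ball (z : EuclideanSpace ℝ (Fin N)) (r z) := by
    intro y hy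
    obtain ⟨x, hx, hyx⟩ := mem_iUnion₂.1 (hcover (subset_closure hy))
    exact mem_iUnion.2 ⟨⟨x, hx⟩, hy, hyx⟩
  calc ∫⁻ x in Ω, ‖H1.toL2 u x‖ₑ ^ p
      ≤ ∫⁻ x in ⋃ z : t, Ω ∩ ball (z : EuclideanSpace ℝ (Fin N)) (r z), ‖H1.toL2 u x‖ₑ ^ p :=
        lintegral_mono_set hsub
    _ ≤ ∑ z ∈ t, ∫⁻ x in Ω ∩ ball z (r z), ‖H1.toL2 u x‖ₑ ^ p := by
        refine (lintegral_iUnion_le _ _).trans_eq ?_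
        rw [tsum_fintype]
        exact Finset.sum_coe_sort t
          (fun z => ∫⁻ x in Ω ∩ ball z (r z), ‖H1.toL2 u x‖ₑ ^ p)
    _ ≤ ∑ z ∈ t, C z * ‖u‖ₑ ^ p := Finset.sum_le_sum fun z hz => hC z (ht z hz) u
    _ = _ := by push_cast; rw [Finset.sum_mul]

end Sobolev

/-! ### Growth of the potential -/

/-- The growth assumption on `f''`, with exponent `p > 2`. -/
structure HasGrowth (f : ℝ → ℝ) (p C : ℝ) : Prop where
  contDiff : ContDiff ℝ 2 f
  two_lt : 2 < p
  C_pos : 0 < C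
  abs_deriv_deriv_le : ∀ s, |deriv (deriv f) s| ≤ C * (|s| ^ (p / 2 - 1) + 1)

namespace HasGrowth

variable {f : ℝ → ℝ} {p C : ℝ}

theorem differentiable (h : HasGrowth f p C) : Differentiable ℝ f :=
  h.contDiff.differentiable (by norm_num)

theorem contDiff_deriv (h : HasGrowth f p C) : ContDiff ℝ 1 (deriv f) :=
  ((contDiff_succ_iff_deriv (n := 1)).1 h.contDiff).2.2

theorem rpow_abs_le_add {q a b s : ℝ} (hq : 0 ≤ q) (hs : s ∈ uIcc a b) :
    |s| ^ q ≤ |a| ^ q + |b| ^ q := by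
  have h1 : |s| ≤ max |a| |b| := by
    rcases le_total a b with hab | hab
    · rw [uIcc_of_le hab] at hs
      exact abs_le_max_abs_abs hs.1 hs.2
    · rw [uIcc_of_ge hab] at hs
      rw [max_comm]
      exact abs_le_max_abs_abs hs.1 hs.2
  have ha : 0 ≤ |a| ^ q := by positivity
  have hb : 0 ≤ |b| ^ q := by positivity
  rcases le_max_iff.1 h1 with h2 | h2
  · linarith [Real.rpow_le_rpow (abs_nonneg s) h2 hq]
  · linarith [Real.rpow_le_rpow (abs_nonneg s) h2 hq]

theorem abs_deriv_sub_le (h : HasGrowth f p C) {a b s : ℝ} (hs : s ∈ uIcc a b) :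
    |deriv f s - deriv f a| ≤ C * (|a| ^ (p / 2 - 1) + |b| ^ (p / 2 - 1) + 1) * |b - a| := by
  have hq : 0 ≤ p / 2 - 1 := by linarith [h.two_lt]
  have hC := h.C_pos
  have h1 := Convex.norm_image_sub_le_of_norm_deriv_le (f := deriv f) (s := uIcc a b)
    (C := C * (|a| ^ (p / 2 - 1) + |b| ^ (p / 2 - 1) + 1))
    (fun x _ => h.contDiff_deriv.differentiable one_ne_zero x)
    (fun x hx => (h.abs_deriv_deriv_le x).trans
      (by have := rpow_abs_le_add hq hx; gcongr)) (convex_uIcc a b) left_mem_uIcc hs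
  refine h1.trans ?_
  gcongr
  rw [Real.norm_eq_abs]
  exact abs_sub_left_of_mem_uIcc hs

/-- The mean value inequality for `s ↦ f s - f' a * s`, whose derivative is controlled by
`abs_deriv_sub_le`; the factor `1/2` is not needed. -/
theorem taylor_le (h : HasGrowth f p C) (a b : ℝ) :
    |f b - f a - deriv f a * (b - a)| ≤
      C * (|a| ^ (p / 2 - 1) + |b| ^ (p / 2 - 1) + 1) * (b - a) ^ 2 := by
  have hd : ∀ x, HasDerivAt (fun s => f s - deriv f a * s) (deriv f x - deriv f a) x := fun x => by
    have h1 := ((hasDerivAt_id x).const_mul (deriv f a))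
    rw [mul_one] at h1
    exact (h.differentiable x).hasDerivAt.sub h1
  have h1 := Convex.norm_image_sub_le_of_norm_hasDerivWithin_le (s := uIcc a b)
    (fun x _ => (hd x).hasDerivWithinAt)
    (fun x hx => h.abs_deriv_sub_le hx) (convex_uIcc a b) left_mem_uIcc right_mem_uIcc
  rw [Real.norm_eq_abs, Real.norm_eq_abs, mul_assoc, ← sq, sq_abs] at h1
  convert h1 using 2
  ring

/-- The exponent `p/2` is what puts `f'(u)` in `L²` when `u` is in `L^p`. -/
theorem abs_deriv_le (h : HasGrowth f p C) :
    ∃ C₁ > 0, ∀ s, |deriv f s| ≤ C₁ * (|s| ^ (p / 2) + 1) := by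
  have hC := h.C_pos
  have hp := h.two_lt
  refine ⟨2 * C + |deriv f 0|, by positivity, fun s => ?_⟩
  have h1 := h.abs_deriv_sub_le (a := 0) (b := s) right_mem_uIcc
  rw [abs_zero, Real.zero_rpow (by linarith), zero_add, sub_zero, mul_assoc, add_mul, one_mul] at h1
  have h2 : |s| ^ (p / 2 - 1) * |s| = |s| ^ (p / 2) := by
    rw [← Real.rpow_add_one' (abs_nonneg s) (by linarith)]
    congr 1; ring
  have h3 : |s| ≤ |s| ^ (p / 2) + 1 := by
    rcases le_total 1 |s| with h4 | h4
    · have := Real.rpow_le_rpow_of_exponent_le h4 (show 1 ≤ p / 2 by linarith)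
      rw [Real.rpow_one] at this
      linarith
    · have : 0 ≤ |s| ^ (p / 2) := by positivity
      linarith
  rw [h2] at h1
  have h5 : |deriv f s| ≤ |deriv f s - deriv f 0| + |deriv f 0| := by
    have := abs_add_le (deriv f s - deriv f 0) (deriv f 0)
    simpa using this
  have h6 : 0 ≤ |s| ^ (p / 2) := by positivity
  nlinarith [abs_nonneg (deriv f 0), mul_le_mul_of_nonneg_left h3 hC.le,
    mul_nonneg (abs_nonneg (deriv f 0)) h6]

theorem abs_sub_le (h : HasGrowth f p C) :
    ∃ C₂ > 0, ∀ a b, |f b - f a| ≤ C₂ * (|a| ^ (p / 2) + |b| ^ (p / 2) + 1) * |b - a| := by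
  obtain ⟨C₁, hC₁, h1⟩ := h.abs_deriv_le
  have hp := h.two_lt
  refine ⟨C₁, hC₁, fun a b => ?_⟩
  exact Convex.norm_image_sub_le_of_norm_deriv_le (s := uIcc a b)
    (fun x _ => h.differentiable x)
    (fun x hx => (h1 x).trans
      (by have := rpow_abs_le_add (show 0 ≤ p / 2 by linarith) hx; gcongr))
    (convex_uIcc a b) left_mem_uIcc right_mem_uIcc

end HasGrowth

/-- The Sobolev embedding `H¹(Ω) ⊂ L^p(Ω)` holds with constant `S`. -/
def HasSobolevBound (Ω : Set (EuclideanSpace ℝ (Fin N))) (p : ℝ) (S : ℝ≥0) : Prop :=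
  ∀ u : H1 Ω, ∫⁻ x in Ω, ‖H1.toL2 u x‖ₑ ^ p ≤ S * ‖u‖ₑ ^ p

/-! ### Weighted integral estimates from the Sobolev bound -/

section Integrals

variable {Ω : Set (EuclideanSpace ℝ (Fin N))} {p : ℝ} {S : ℝ≥0}

theorem integral_mul_le_sqrt_mul_sqrt {h k : EuclideanSpace ℝ (Fin N) → ℝ}
    (hh : MemLp h 2 (volume.restrict Ω)) (hk : MemLp k 2 (volume.restrict Ω)) :
    ∫ x in Ω, |h x| * |k x| ≤ √(∫ x in Ω, h x ^ 2) * √(∫ x in Ω, k x ^ 2) := by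
  have := integral_mul_le_Lp_mul_Lq_of_nonneg (μ := volume.restrict Ω)
    Real.HolderConjugate.two_two (f := fun x => |h x|) (g := fun x => |k x|)
    (Eventually.of_forall fun x => abs_nonneg _) (Eventually.of_forall fun x => abs_nonneg _)
    (by simpa using! hh.abs) (by simpa using! hk.abs)
  simpa [Real.sqrt_eq_rpow] using this

theorem inner_real_eq_mul (a b : ℝ) : ⟪a, b⟫ = a * b := by
  rw [real_inner_eq_re_inner]
  simp [mul_comm]

theorem L2_inner_eq (u v : L2 Ω) : ⟪u, v⟫ = ∫ x in Ω, u x * v x := by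
  simp only [L2.inner_def, inner_real_eq_mul]

theorem integral_toL2_sq (u : L2 Ω) : ∫ x in Ω, u x ^ 2 = ‖u‖ ^ 2 := by
  rw [← real_inner_self_eq_norm_sq, L2.inner_def]
  simp [sq]

theorem integral_norm_sq (u : L2Vec Ω) : ∫ x in Ω, ‖u x‖ ^ 2 = ‖u‖ ^ 2 := by
  rw [← real_inner_self_eq_norm_sq, L2.inner_def]
  simp

theorem enorm_rpow_eq_ofReal {p : ℝ} (hp : 0 ≤ p) (y : ℝ) : ‖y‖ₑ ^ p = ENNReal.ofReal (|y| ^ p) := by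
  rw [← ofReal_norm, ENNReal.ofReal_rpow_of_nonneg (norm_nonneg _) hp, Real.norm_eq_abs]

theorem aestronglyMeasurable_abs_rpow (u : L2 Ω) {q : ℝ} (hq : 0 ≤ q) :
    AEStronglyMeasurable (fun x => |u x| ^ q) (volume.restrict Ω) := by
  have hc : Continuous fun y : ℝ => |y| ^ q := continuous_abs.rpow_const fun _ => Or.inr hq
  exact hc.comp_aestronglyMeasurable (Lp.aestronglyMeasurable u)

theorem HasSobolevBound.integrable (hS : HasSobolevBound Ω p S) (hp : 2 < p) (u : H1 Ω) :
    Integrable (fun x => |H1.toL2 u x| ^ p) (volume.restrict Ω) := by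
  refine ⟨aestronglyMeasurable_abs_rpow _ (by linarith), ?_⟩
  refine lt_of_le_of_lt (le_trans (le_of_eq ?_) (hS u)) ?_
  · refine lintegral_congr fun x => ?_
    rw [Real.enorm_rpow_of_nonneg (abs_nonneg _) (by linarith), Real.enorm_abs]
  · exact ENNReal.mul_lt_top (by simp) (ENNReal.rpow_lt_top_of_nonneg (by linarith) (by simp))

theorem HasSobolevBound.integral_le (hS : HasSobolevBound Ω p S) (hp : 2 < p) (u : H1 Ω) :
    ∫ x in Ω, |H1.toL2 u x| ^ p ≤ S * ‖u‖ ^ p := by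
  have h1 := hS u
  simp_rw [enorm_rpow_eq_ofReal (show 0 ≤ p by linarith)] at h1
  rw [← ofReal_integral_eq_lintegral_ofReal (hS.integrable hp u)
    (Eventually.of_forall fun x => by positivity)] at h1
  rw [← ofReal_norm, ENNReal.ofReal_rpow_of_nonneg (norm_nonneg _) (by linarith),
    ← ENNReal.ofReal_coe_nnreal, ← ENNReal.ofReal_mul (by positivity)] at h1
  exact (ENNReal.ofReal_le_ofReal_iff (by positivity)).1 h1

theorem HasSobolevBound.memLp_abs_rpow_half (hS : HasSobolevBound Ω p S) (hp : 2 < p) (u : H1 Ω) :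
    MemLp (fun x => |H1.toL2 u x| ^ (p / 2)) 2 (volume.restrict Ω) := by
  rw [memLp_two_iff_integrable_sq (aestronglyMeasurable_abs_rpow _ (by linarith))]
  refine (hS.integrable hp u).congr (Eventually.of_forall fun x => ?_)
  simp only
  rw [← Real.rpow_natCast, ← Real.rpow_mul (abs_nonneg _)]
  congr 1; push_cast; ring

theorem rpow_sub_two_mul_sq_le {x y : ℝ} (hx : 0 ≤ x) (hy : 0 ≤ y) (hp : 2 < p) :
    x ^ (p - 2) * y ^ 2 ≤ x ^ p + y ^ p := by
  have key : ∀ z : ℝ, 0 ≤ z → z ^ (p - 2) * z ^ 2 = z ^ p := fun z hz => by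
    rw [← Real.rpow_natCast, ← Real.rpow_add' hz (by push_cast; linarith)]
    congr 1; push_cast; ring
  have hxp : 0 ≤ x ^ p := by positivity
  have hyp : 0 ≤ y ^ p := by positivity
  rcases le_total x y with h | h
  · calc x ^ (p - 2) * y ^ 2 ≤ y ^ (p - 2) * y ^ 2 := by
          gcongr
      _ ≤ _ := by rw [key y hy]; linarith
  · calc x ^ (p - 2) * y ^ 2 ≤ x ^ (p - 2) * x ^ 2 := by gcongr
      _ ≤ _ := by rw [key x hx]; linarith

/-- A substitute for Hölder with exponents `p/(p-2)` and `p/2`: the pointwise bound `x^(p-2) y² ≤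
x^p + y^p` is used with `y = |d|/‖d‖`, which makes the result quadratic in `‖d‖`. The case `‖d‖ = 0`
is treated apart because of the division. -/
theorem HasSobolevBound.weighted (hS : HasSobolevBound Ω p S) (hp : 2 < p) {M : ℝ}
    {a d : H1 Ω} (ha : ‖a‖ ≤ M) :
    MemLp (fun x => |H1.toL2 a x| ^ (p / 2 - 1) * |H1.toL2 d x|) 2 (volume.restrict Ω) ∧
    ∫ x in Ω, (|H1.toL2 a x| ^ (p / 2 - 1) * |H1.toL2 d x|) ^ 2 ≤ S * (M ^ p + 1) * ‖d‖ ^ 2 := by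
  have hM : 0 ≤ M := (norm_nonneg a).trans ha
  have hmeas : AEStronglyMeasurable
      (fun x => |H1.toL2 a x| ^ (p / 2 - 1) * |H1.toL2 d x|) (volume.restrict Ω) :=
    (aestronglyMeasurable_abs_rpow _ (by linarith)).mul
      (continuous_abs.comp_aestronglyMeasurable (Lp.aestronglyMeasurable _))
  rw [memLp_two_iff_integrable_sq hmeas]
  rcases (norm_nonneg d).eq_or_lt with hd | hd
  · have hd0 : H1.toL2 d = 0 := by
      rw [norm_eq_zero.1 hd.symm, map_zero]
    have hz : (fun x => (|H1.toL2 a x| ^ (p / 2 - 1) * |H1.toL2 d x|) ^ 2)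
        =ᵐ[volume.restrict Ω] fun _ => 0 := by
      rw [hd0]
      filter_upwards [Lp.coeFn_zero ℝ 2 (volume.restrict Ω)] with x hx
      rw [hx]
      simp
    refine ⟨(integrable_zero _ _ _).congr hz.symm, ?_⟩
    rw [integral_congr_ae hz]
    simp
    positivity
  · have hpt : ∀ x, (|H1.toL2 a x| ^ (p / 2 - 1) * |H1.toL2 d x|) ^ 2 ≤
        ‖d‖ ^ 2 * (|H1.toL2 a x| ^ p + |H1.toL2 d x| ^ p / ‖d‖ ^ p) := by
      intro x
      have h1 := rpow_sub_two_mul_sq_le (abs_nonneg (H1.toL2 a x))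
        (div_nonneg (abs_nonneg (H1.toL2 d x)) hd.le) hp
      rw [Real.div_rpow (abs_nonneg _) hd.le] at h1
      have h2 : (|H1.toL2 a x| ^ (p / 2 - 1)) ^ 2 = |H1.toL2 a x| ^ (p - 2) := by
        rw [← Real.rpow_natCast, ← Real.rpow_mul (abs_nonneg _)]
        congr 1; push_cast; ring
      rw [mul_pow, h2]
      calc |H1.toL2 a x| ^ (p - 2) * |H1.toL2 d x| ^ 2
          = ‖d‖ ^ 2 * (|H1.toL2 a x| ^ (p - 2) * (|H1.toL2 d x| / ‖d‖) ^ 2) := by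
            field_simp
        _ ≤ _ := by gcongr
    have hint : Integrable (fun x => ‖d‖ ^ 2 * (|H1.toL2 a x| ^ p + |H1.toL2 d x| ^ p / ‖d‖ ^ p))
        (volume.restrict Ω) :=
      ((hS.integrable hp a).add ((hS.integrable hp d).div_const _)).const_mul _
    have hi : Integrable (fun x => (|H1.toL2 a x| ^ (p / 2 - 1) * |H1.toL2 d x|) ^ 2)
        (volume.restrict Ω) := by
      refine hint.mono' (hmeas.pow 2) (Eventually.of_forall fun x => ?_)
      rw [Real.norm_of_nonneg (sq_nonneg _)]
      exact hpt x
    refine ⟨hi, (integral_mono hi hint hpt).trans ?_⟩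
    rw [integral_const_mul, integral_add (hS.integrable hp a) ((hS.integrable hp d).div_const _),
      integral_div]
    have h3 : (∫ x in Ω, |H1.toL2 a x| ^ p) ≤ S * M ^ p :=
      (hS.integral_le hp a).trans (by gcongr)
    have h4 : (∫ x in Ω, |H1.toL2 d x| ^ p) / ‖d‖ ^ p ≤ S := by
      rw [div_le_iff₀ (by positivity)]
      exact hS.integral_le hp d
    nlinarith [mul_le_mul_of_nonneg_left (add_le_add h3 h4) (sq_nonneg ‖d‖)]

/-- Cauchy-Schwarz puts the weight on only one copy of `d`. The other copy is left in plain `L²`,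
which later makes the term absorbable. -/
theorem HasSobolevBound.integral_weight_mul_sq_le (hS : HasSobolevBound Ω p S) (hp : 2 < p)
    {M : ℝ} {a d : H1 Ω} (ha : ‖a‖ ≤ M) :
    Integrable (fun x => |H1.toL2 a x| ^ (p / 2 - 1) * H1.toL2 d x ^ 2) (volume.restrict Ω) ∧
    ∫ x in Ω, |H1.toL2 a x| ^ (p / 2 - 1) * H1.toL2 d x ^ 2 ≤
      √(S * (M ^ p + 1)) * ‖d‖ * ‖H1.toL2 d‖ := by
  obtain ⟨h1, h2⟩ := hS.weighted hp (d := d) ha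
  have hd := Lp.memLp (H1.toL2 d)
  have heq : (fun x => |H1.toL2 a x| ^ (p / 2 - 1) * H1.toL2 d x ^ 2) = fun x =>
      |(|H1.toL2 a x| ^ (p / 2 - 1) * |H1.toL2 d x|)| * |H1.toL2 d x| := by
    ext x
    rw [abs_mul, abs_abs, abs_of_nonneg (Real.rpow_nonneg (abs_nonneg _) _), mul_assoc, ← sq,
      sq_abs]
  rw [heq]
  refine ⟨h1.abs.integrable_mul hd.abs, (integral_mul_le_sqrt_mul_sqrt h1 hd).trans ?_⟩
  rw [integral_toL2_sq, Real.sqrt_sq (norm_nonneg _)]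
  gcongr
  refine (Real.sqrt_le_sqrt h2).trans_eq ?_
  rw [Real.sqrt_mul' _ (sq_nonneg _), Real.sqrt_sq (norm_nonneg _)]

end Integrals

/-! ### Semiconvexity and continuity of the energy -/

section Energy

variable {Ω : Set (EuclideanSpace ℝ (Fin N))} {f : ℝ → ℝ} {p C ε : ℝ} {S : ℝ≥0}

theorem HasGrowth.memLp_deriv_comp (hf : HasGrowth f p C) (hS : HasSobolevBound Ω p S)
    [IsFiniteMeasure (volume.restrict Ω)] (u : H1 Ω) :
    MemLp (fun x => deriv f (H1.toL2 u x)) 2 (volume.restrict Ω) := by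
  obtain ⟨C₁, hC₁, h1⟩ := hf.abs_deriv_le
  refine MemLp.mono' (g := fun x => C₁ * (|H1.toL2 u x| ^ (p / 2) + 1)) ?_ ?_
    (Eventually.of_forall fun x => h1 _)
  · exact ((hS.memLp_abs_rpow_half hf.two_lt u).add (memLp_const 1)).const_mul C₁
  · exact hf.contDiff_deriv.continuous.comp_aestronglyMeasurable (Lp.aestronglyMeasurable _)

theorem HasGrowth.integrable_comp (hf : HasGrowth f p C) (hS : HasSobolevBound Ω p S)
    [IsFiniteMeasure (volume.restrict Ω)] (u : H1 Ω) :
    Integrable (fun x => f (H1.toL2 u x)) (volume.restrict Ω) := by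
  obtain ⟨C₂, hC₂, h1⟩ := hf.abs_sub_le
  have hp := hf.two_lt
  have h2 : Integrable (fun x => C₂ * ((|H1.toL2 u x| ^ (p / 2) + 1) * |H1.toL2 u x|) + |f 0|)
      (volume.restrict Ω) := by
    refine Integrable.add (Integrable.const_mul ?_ _) (integrable_const _)
    exact MemLp.integrable_mul ((hS.memLp_abs_rpow_half hp u).add (memLp_const 1))
      (Lp.memLp (H1.toL2 u)).abs
  refine h2.mono' (hf.contDiff.continuous.comp_aestronglyMeasurable (Lp.aestronglyMeasurable _))
    (Eventually.of_forall fun x => ?_)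
  have h3 := h1 0 (H1.toL2 u x)
  rw [abs_zero, Real.zero_rpow (by linarith), zero_add, sub_zero, mul_assoc] at h3
  have h4 := abs_add_le (f (H1.toL2 u x) - f 0) (f 0)
  rw [sub_add_cancel] at h4
  rw [Real.norm_eq_abs]
  linarith

theorem HasGrowth.energy_eq (hf : HasGrowth f p C) (hS : HasSobolevBound Ω p S)
    [IsFiniteMeasure (volume.restrict Ω)] (u : H1 Ω) :
    energy f ε u = 1 / ε * (∫ x in Ω, f (H1.toL2 u x)) + ε / 2 * ‖H1.grad u‖ ^ 2 := by
  unfold energy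
  rw [integral_add ((hf.integrable_comp hS u).const_mul _)
    ((Lp.memLp (H1.grad u)).integrable_norm_pow two_ne_zero |>.const_mul _),
    integral_const_mul, integral_const_mul, integral_norm_sq]

theorem H1.toDual_apply_eq_inner (u ξ : H1 Ω) : H1.toDual u ξ = ⟪H1.toL2 u, H1.toL2 ξ⟫ := by
  unfold H1.toDual
  simp only [ContinuousLinearMap.comp_apply, innerSL_apply_apply]

theorem H1.toDual_apply (u ξ : H1 Ω) :
    H1.toDual u ξ = ∫ x in Ω, H1.toL2 u x * H1.toL2 ξ x := by
  rw [H1.toDual_apply_eq_inner, L2_inner_eq]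

theorem H1.toDual_self (u : H1 Ω) : H1.toDual u u = ‖H1.toL2 u‖ ^ 2 := by
  rw [H1.toDual_apply_eq_inner, real_inner_self_eq_norm_sq]

/-- Interpolation of `L²` between `H¹*` and `H¹`, obtained by pairing `u` with itself. -/
theorem H1.norm_toL2_sq_le (u : H1 Ω) : ‖H1.toL2 u‖ ^ 2 ≤ ‖H1.toDual u‖ * ‖u‖ := by
  rw [← H1.toDual_self]
  exact (le_abs_self _).trans ((H1.toDual u).le_opNorm u)

theorem IsChemicalPotential.toDual_eq (hf : HasGrowth f p C) (hS : HasSobolevBound Ω p S)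
    [IsFiniteMeasure (volume.restrict Ω)] {u m : H1 Ω} (h : IsChemicalPotential f ε u m)
    (ξ : H1 Ω) :
    H1.toDual ξ m = ε * ⟪H1.grad u, H1.grad ξ⟫ +
      1 / ε * ∫ x in Ω, deriv f (H1.toL2 u x) * H1.toL2 ξ x := by
  have h1 := h ξ
  rw [H1.toDual_apply]
  simp_rw [mul_comm (H1.toL2 ξ _)]
  rw [h1, L2.inner_def]
  simp_rw [mul_assoc]
  rw [integral_add, integral_const_mul, integral_const_mul]
  · exact (L2.integrable_inner _ _).const_mul _
  · exact ((hf.memLp_deriv_comp hS u).integrable_mul (Lp.memLp _)).const_mul _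

theorem HasGrowth.abs_integral_taylor_le (hf : HasGrowth f p C) (hS : HasSobolevBound Ω p S)
    [IsFiniteMeasure (volume.restrict Ω)] {M : ℝ} {a b : H1 Ω} (ha : ‖a‖ ≤ M) (hb : ‖b‖ ≤ M) :
    |(∫ x in Ω, f (H1.toL2 b x)) - (∫ x in Ω, f (H1.toL2 a x)) -
      ∫ x in Ω, deriv f (H1.toL2 a x) * H1.toL2 (b - a) x| ≤
      C * (2 * √(S * (M ^ p + 1)) + 1) * ‖b - a‖ * ‖H1.toL2 (b - a)‖ := by
  have hp := hf.two_lt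
  have hC := hf.C_pos
  obtain ⟨hai, hale⟩ := hS.integral_weight_mul_sq_le hp (d := b - a) ha
  obtain ⟨hbi, hble⟩ := hS.integral_weight_mul_sq_le hp (d := b - a) hb
  have hdi : Integrable (fun x => H1.toL2 (b - a) x ^ 2) (volume.restrict Ω) :=
    (Lp.memLp (H1.toL2 (b - a))).integrable_sq
  have hfd : Integrable (fun x => deriv f (H1.toL2 a x) * H1.toL2 (b - a) x)
      (volume.restrict Ω) :=
    (hf.memLp_deriv_comp hS a).integrable_mul (Lp.memLp (H1.toL2 (b - a)))
  have hfa := hf.integrable_comp hS a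
  have hfb := hf.integrable_comp hS b
  have hd : H1.toL2 (b - a) =ᵐ[volume.restrict Ω] fun x => H1.toL2 b x - H1.toL2 a x := by
    rw [map_sub]; exact Lp.coeFn_sub _ _
  have hfab : Integrable (fun x => f (H1.toL2 b x) - f (H1.toL2 a x)) (volume.restrict Ω) :=
    hfb.sub hfa
  rw [← integral_sub hfb hfa, ← integral_sub hfab hfd]
  have hbound : ∫ x in Ω, C * (|H1.toL2 a x| ^ (p / 2 - 1) * H1.toL2 (b - a) x ^ 2 +
      |H1.toL2 b x| ^ (p / 2 - 1) * H1.toL2 (b - a) x ^ 2 + H1.toL2 (b - a) x ^ 2) ≤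
      C * (2 * √(S * (M ^ p + 1)) + 1) * ‖b - a‖ * ‖H1.toL2 (b - a)‖ := by
    rw [integral_const_mul, integral_add (by exact hai.add hbi) hdi, integral_add hai hbi,
      integral_toL2_sq]
    have h1 : ‖H1.toL2 (b - a)‖ ^ 2 ≤ ‖b - a‖ * ‖H1.toL2 (b - a)‖ := by
      rw [sq]; gcongr; exact H1.norm_toL2_le _
    calc _ ≤ C * (√(S * (M ^ p + 1)) * ‖b - a‖ * ‖H1.toL2 (b - a)‖ +
          √(S * (M ^ p + 1)) * ‖b - a‖ * ‖H1.toL2 (b - a)‖ + ‖b - a‖ * ‖H1.toL2 (b - a)‖) := by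
            gcongr
      _ = _ := by ring
  refine le_trans ?_ hbound
  rw [← Real.norm_eq_abs]
  refine norm_integral_le_of_norm_le (((hai.add hbi).add hdi).const_mul C) ?_
  filter_upwards [hd] with x hx
  rw [hx, Real.norm_eq_abs]
  refine (hf.taylor_le _ _).trans_eq ?_
  ring

/-- The energy is semiconvex with respect to the `H¹(Ω)*` norm on bounded sets of `H¹(Ω)`, and
the chemical potential is its subgradient. -/
theorem HasGrowth.exists_energy_sub_ge (hf : HasGrowth f p C) (hS : HasSobolevBound Ω p S)
    [IsFiniteMeasure (volume.restrict Ω)] (hε : 0 < ε) (M : ℝ) :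
    ∃ K ≥ 0, ∀ a b m : H1 Ω, ‖a‖ ≤ M → ‖b‖ ≤ M → IsChemicalPotential f ε a m →
      ε / 4 * ‖b - a‖ ^ 2 - K * ‖H1.toDual (b - a)‖ ^ 2 ≤
        energy f ε b - energy f ε a - H1.toDual (b - a) m := by
  set L := 1 / ε * (C * (2 * √(S * (M ^ p + 1)) + 1)) with hL
  have hC := hf.C_pos
  have hL0 : 0 < L := by positivity
  -- The total coefficient of `Y²`: `ε/2` from `‖∇d‖² = X² - Y²`, and `4L²/ε` from Young's
  -- inequality for `L X Y`. Each use of Young's inequality costs `ε/16` of the available `ε/2 ·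
  -- X²`, leaving more than `ε/4`.
  set K₁ := ε / 2 + 4 * L ^ 2 / ε with hK₁
  have hK₁0 : 0 < K₁ := by positivity
  refine ⟨4 * K₁ ^ 2 / ε, by positivity, fun a b m ha hb hm => ?_⟩
  rw [hf.energy_eq hS, hf.energy_eq hS, hm.toDual_eq hf hS]
  have hT := hf.abs_integral_taylor_le hS ha hb
  set T := (∫ x in Ω, f (H1.toL2 b x)) - (∫ x in Ω, f (H1.toL2 a x)) -
      ∫ x in Ω, deriv f (H1.toL2 a x) * H1.toL2 (b - a) x with hTdef
  have hgrad : ‖H1.grad b‖ ^ 2 = ‖H1.grad a‖ ^ 2 + 2 * ⟪H1.grad a, H1.grad (b - a)⟫ +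
      ‖H1.grad (b - a)‖ ^ 2 := by
    rw [← norm_add_sq_real, ← map_add, add_sub_cancel]
  have hX := H1.norm_sq_eq (b - a)
  have hYZ := H1.norm_toL2_sq_le (b - a)
  set X := ‖b - a‖
  set Y := ‖H1.toL2 (b - a)‖
  set Z := ‖H1.toDual (b - a)‖
  have hX0 : 0 ≤ X := norm_nonneg _
  have hZ0 : 0 ≤ Z := norm_nonneg (H1.toDual (b - a))
  have hT2 : -(L * X * Y) ≤ 1 / ε * T := by
    have h1 := (abs_le.1 hT).1
    have h2 := mul_le_mul_of_nonneg_left h1 (show 0 ≤ 1 / ε by positivity)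
    refine le_trans (le_of_eq ?_) h2
    rw [hL]; ring
  have h1 : L * X * Y ≤ ε / 16 * X ^ 2 + 4 * L ^ 2 / ε * Y ^ 2 := by
    have : 0 ≤ (ε / 8 * X - L * Y) ^ 2 * (4 / ε) := by positivity
    have h2 : (ε / 8 * X - L * Y) ^ 2 * (4 / ε) =
        ε / 16 * X ^ 2 + 4 * L ^ 2 / ε * Y ^ 2 - L * X * Y := by
      field_simp; ring
    linarith
  have h3 : K₁ * (Z * X) ≤ ε / 16 * X ^ 2 + 4 * K₁ ^ 2 / ε * Z ^ 2 := by
    have : 0 ≤ (ε / 8 * X - K₁ * Z) ^ 2 * (4 / ε) := by positivity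
    have h2 : (ε / 8 * X - K₁ * Z) ^ 2 * (4 / ε) =
        ε / 16 * X ^ 2 + 4 * K₁ ^ 2 / ε * Z ^ 2 - K₁ * (Z * X) := by
      field_simp; ring
    linarith
  have h4 : K₁ * Y ^ 2 ≤ K₁ * (Z * X) := by gcongr
  have h5 : K₁ * Y ^ 2 = ε / 2 * Y ^ 2 + 4 * L ^ 2 / ε * Y ^ 2 := by rw [hK₁]; ring
  have h6 : 1 / ε * T + ε / 2 * ‖H1.grad (b - a)‖ ^ 2 =
      1 / ε * (∫ x in Ω, f (H1.toL2 b x)) + ε / 2 * ‖H1.grad b‖ ^ 2 -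
      (1 / ε * (∫ x in Ω, f (H1.toL2 a x)) + ε / 2 * ‖H1.grad a‖ ^ 2) -
      (ε * ⟪H1.grad a, H1.grad (b - a)⟫ +
        1 / ε * ∫ x in Ω, deriv f (H1.toL2 a x) * H1.toL2 (b - a) x) := by
    rw [hgrad, hTdef]; ring
  rw [← h6]
  have h7 : ε / 2 * ‖H1.grad (b - a)‖ ^ 2 = ε / 2 * X ^ 2 - ε / 2 * Y ^ 2 := by rw [hX]; ring
  rw [h7]
  have h8 : 0 ≤ ε * X ^ 2 := by positivity
  linarith

/-- The potential part is expanded at the limit `v`: the linear term is an `L²` pairing with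
`f'(v)`, and the remainder is quadratic in `‖u n - v‖`. -/
theorem HasGrowth.tendsto_energy (hf : HasGrowth f p C) (hS : HasSobolevBound Ω p S)
    [IsFiniteMeasure (volume.restrict Ω)] {ι : Type*} {l : Filter ι} {u : ι → H1 Ω} {v : H1 Ω}
    (hu : Tendsto u l (𝓝 v)) :
    Tendsto (fun n => energy f ε (u n)) l (𝓝 (energy f ε v)) := by
  simp_rw [hf.energy_eq hS]
  have hgrad : Tendsto (fun n => ‖H1.grad (u n)‖ ^ 2) l (𝓝 (‖H1.grad v‖ ^ 2)) :=
    (((H1.grad (Ω := Ω)).continuous.tendsto v).comp hu).norm.pow 2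
  refine Tendsto.add (Tendsto.const_mul _ ?_) (hgrad.const_mul _)
  set M := ‖v‖ + 1
  have hM : ∀ᶠ n in l, ‖u n‖ ≤ M :=
    (hu.norm.eventually (gt_mem_nhds (lt_add_one ‖v‖))).mono fun n hn => le_of_lt hn
  have hdiff : Tendsto (fun n => u n - v) l (𝓝 0) := by simpa using hu.sub_const v
  have hlin : Tendsto (fun n => ∫ x in Ω, deriv f (H1.toL2 v x) * H1.toL2 (u n - v) x) l (𝓝 0) := by
    have hm := hf.memLp_deriv_comp hS v
    have heq : ∀ ξ : H1 Ω, ∫ x in Ω, deriv f (H1.toL2 v x) * H1.toL2 ξ x =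
        ⟪hm.toLp, H1.toL2 ξ⟫ := fun ξ => by
      rw [L2_inner_eq]
      refine integral_congr_ae ?_
      filter_upwards [hm.coeFn_toLp] with x hx
      rw [hx]
    simp_rw [heq]
    have h1 : Tendsto (fun n => H1.toL2 (u n - v)) l (𝓝 0) := by
      have h2 := ((H1.toL2 (Ω := Ω)).continuous.tendsto 0).comp hdiff
      rwa [map_zero] at h2
    have h3 := (tendsto_const_nhds (x := hm.toLp)).inner (𝕜 := ℝ) h1
    rwa [inner_zero_right] at h3
  have hrem : Tendsto (fun n => (∫ x in Ω, f (H1.toL2 (u n) x)) - (∫ x in Ω, f (H1.toL2 v x)) -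
      ∫ x in Ω, deriv f (H1.toL2 v x) * H1.toL2 (u n - v) x) l (𝓝 0) := by
    refine squeeze_zero_norm' (a := fun n =>
      C * (2 * √(S * (M ^ p + 1)) + 1) * ‖u n - v‖ * ‖u n - v‖) ?_ ?_
    · filter_upwards [hM] with n hn
      refine (hf.abs_integral_taylor_le hS (by linarith [lt_add_one ‖v‖]) hn).trans ?_
      have := hf.C_pos
      gcongr
      exact H1.norm_toL2_le _
    · simpa using (hdiff.norm.const_mul (C * (2 * √(S * (M ^ p + 1)) + 1))).mul hdiff.norm
  have := (hrem.add hlin).add_const (∫ x in Ω, f (H1.toL2 v x))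
  simpa using this

end Energy

/-! ### Weak time derivatives and primitives -/

section DuBoisReymond

variable {V : Type*} [NormedAddCommGroup V] [NormedSpace ℝ V] {T : ℝ}

/-- The mean-zero condition makes the primitive from 0 vanish to the right of the support, so it is
again compactly supported in the interval. -/
theorem IsTestFunction.exists_primitive {ψ : ℝ → ℝ} (hψ : IsTestFunction (Ioo 0 T) ψ)
    (h0 : ∫ t, ψ t = 0) : ∃ φ, IsTestFunction (Ioo 0 T) φ ∧ deriv φ = ψ := by
  have hc : Continuous ψ := hψ.contDiff.continuous
  have hd : ∀ t, HasDerivAt (fun t => ∫ s in (0 : ℝ)..t, ψ s) (ψ t) t := fun t =>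
    intervalIntegral.integral_hasDerivAt_right (hc.intervalIntegrable _ _)
      (hc.stronglyMeasurableAtFilter _ _) hc.continuousAt
  have hderiv : deriv (fun t => ∫ s in (0 : ℝ)..t, ψ s) = ψ := funext fun t => (hd t).deriv
  obtain ⟨α, β, hα, hβ, hαβ⟩ : ∃ α β : ℝ, 0 < α ∧ (β < T ∨ tsupport ψ = ∅) ∧
      tsupport ψ ⊆ Icc α β := by
    rcases (tsupport ψ).eq_empty_or_nonempty with he | hne
    · exact ⟨1, 1, one_pos, Or.inr he, by simp [he]⟩
    · obtain ⟨α, hα⟩ := hψ.hasCompactSupport.isCompact.exists_isLeast hne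
      obtain ⟨β, hβ⟩ := hψ.hasCompactSupport.isCompact.exists_isGreatest hne
      exact ⟨α, β, (hψ.tsupport_subset hα.1).1, Or.inl (hψ.tsupport_subset hβ.1).2,
        fun t ht => ⟨hα.2 ht, hβ.2 ht⟩⟩
  have hψ0 : ∀ t, t ∉ Icc α β → ψ t = 0 := fun t ht =>
    image_eq_zero_of_notMem_tsupport fun h => ht (hαβ h)
  have hint : Integrable ψ := hc.integrable_of_hasCompactSupport hψ.hasCompactSupport
  have hzero : ∀ t, t ∉ Icc α β → ∫ s in (0 : ℝ)..t, ψ s = 0 := by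
    intro t ht
    rcases lt_or_ge t α with h | h
    · refine (intervalIntegral.integral_congr (g := fun _ => (0 : ℝ)) fun s hs => ?_).trans (by simp)
      refine hψ0 s fun hs2 => ?_
      have := hs.2
      have h3 : max 0 t < α := max_lt hα h
      linarith [hs2.1]
    · have ht2 : β < t := by
        by_contra h2
        exact ht ⟨h, not_lt.1 h2⟩
      have h1 : ∫ s in (0 : ℝ)..t, ψ s = ∫ s, ψ s := by
        rw [intervalIntegral.integral_of_le (by linarith)]
        refine setIntegral_eq_integral_of_forall_compl_eq_zero fun s hs => hψ0 s fun hs2 => hs ?_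
        exact ⟨lt_of_lt_of_le hα hs2.1, hs2.2.trans ht2.le⟩
      rw [h1, h0]
  have hsupp : tsupport (fun t => ∫ s in (0 : ℝ)..t, ψ s) ⊆ Icc α β := by
    refine closure_minimal (fun t ht => ?_) isClosed_Icc
    by_contra h
    exact ht (hzero t h)
  refine ⟨fun t => ∫ s in (0 : ℝ)..t, ψ s, ⟨?_, ?_, ?_⟩, hderiv⟩
  · rw [contDiff_infty_iff_deriv, hderiv]
    exact ⟨fun t => (hd t).differentiableAt, hψ.contDiff⟩
  · exact HasCompactSupport.of_support_subset_isCompact isCompact_Icc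
      ((subset_tsupport _).trans hsupp)
  · rcases hβ with hβ | he
    · exact hsupp.trans fun t ht => ⟨hα.trans_le ht.1, ht.2.trans_lt hβ⟩
    · have hz : ψ = 0 := tsupport_eq_empty_iff.1 he
      have : (fun t => ∫ s in (0 : ℝ)..t, ψ s) = 0 := by
        ext t; simp [hz]
      rw [this]
      simp [tsupport]

/-- The lemma of du Bois-Reymond for Bochner integrals. -/
theorem exists_ae_eq_const_of_integral_deriv_smul_eq_zero [CompleteSpace V] (hT : 0 < T)
    {h : ℝ → V} (hh : IntegrableOn h (Ioo 0 T))
    (h0 : ∀ φ : ℝ → ℝ, IsTestFunction (Ioo 0 T) φ → ∫ t in Ioo 0 T, deriv φ t • h t = 0) :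
    ∃ k, ∀ᵐ t ∂(volume.restrict (Ioo 0 T)), h t = k := by
  let b : ContDiffBump (T / 2) := ⟨T / 8, T / 4, by positivity, by linarith⟩
  set ψ₀ : ℝ → ℝ := b.normed volume with hψ₀def
  have hψ₀ : IsTestFunction (Ioo 0 T) ψ₀ := by
    refine ⟨b.contDiff_normed, b.hasCompactSupport_normed, ?_⟩
    rw [hψ₀def, b.tsupport_normed_eq, Real.closedBall_eq_Icc]
    have hr : b.rOut = T / 4 := rfl
    rw [hr]
    exact fun t ht => ⟨by linarith [ht.1], by linarith [ht.2]⟩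
  have hint : ∀ ψ : ℝ → ℝ, IsTestFunction (Ioo 0 T) ψ →
      IntegrableOn (fun t => ψ t • h t) (Ioo 0 T) := by
    intro ψ hψ
    obtain ⟨K, hK⟩ := hψ.contDiff.continuous.bounded_above_of_compact_support
      hψ.hasCompactSupport
    exact hh.bdd_smul K hψ.contDiff.continuous.aestronglyMeasurable (Eventually.of_forall hK)
  set k := ∫ t in Ioo 0 T, ψ₀ t • h t with hk
  refine ⟨k, ?_⟩
  have hsub : ∀ ψ : ℝ → ℝ, IsTestFunction (Ioo 0 T) ψ → ∫ t, ψ t • (h t - k) = 0 := by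
    intro ψ hψ
    have hψi : Integrable ψ :=
      hψ.contDiff.continuous.integrable_of_hasCompactSupport hψ.hasCompactSupport
    have hout : ∀ t, t ∉ Ioo 0 T → ψ t = 0 := fun t ht =>
      image_eq_zero_of_notMem_tsupport fun h => ht (hψ.tsupport_subset h)
    -- Subtracting a multiple of the unit-mass bump `ψ₀` makes the mean zero, so the difference is
    -- the derivative of a test function.
    have htest : IsTestFunction (Ioo 0 T) (fun t => ψ t - (∫ s, ψ s) * ψ₀ t) := by
      have hs : tsupport (fun t => ψ t - (∫ s, ψ s) * ψ₀ t) ⊆ tsupport ψ ∪ tsupport ψ₀ := by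
        refine closure_minimal (fun t ht => ?_)
          ((isClosed_tsupport _).union (isClosed_tsupport _))
        by_contra hc
        rw [mem_union, not_or] at hc
        apply ht
        simp only
        rw [image_eq_zero_of_notMem_tsupport hc.1, image_eq_zero_of_notMem_tsupport hc.2]
        simp
      refine ⟨hψ.contDiff.sub (contDiff_const.mul hψ₀.contDiff), ?_,
        hs.trans (union_subset hψ.tsupport_subset hψ₀.tsupport_subset)⟩
      exact (hψ.hasCompactSupport.isCompact.union hψ₀.hasCompactSupport.isCompact).of_isClosed_subset
        (isClosed_tsupport _) hs
    obtain ⟨φ, hφ, hφd⟩ := htest.exists_primitive (by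
      rw [integral_sub hψi (b.integrable_normed.const_mul _), integral_const_mul,
        b.integral_normed]
      ring)
    have h1 := h0 φ hφ
    rw [hφd] at h1
    simp only [sub_smul, mul_smul] at h1
    have hi₀ : IntegrableOn (fun t => (∫ s, ψ s) • ψ₀ t • h t) (Ioo 0 T) :=
      (hint ψ₀ hψ₀).smul (∫ s, ψ s)
    rw [integral_sub (hint ψ hψ) hi₀, integral_smul, ← hk] at h1
    have h2 : ∫ t, ψ t • (h t - k) = ∫ t in Ioo 0 T, ψ t • (h t - k) := by
      refine (setIntegral_eq_integral_of_forall_compl_eq_zero fun t ht => ?_).symm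
      rw [hout t ht, zero_smul]
    have h3 : ∫ t in Ioo 0 T, ψ t = ∫ t, ψ t :=
      setIntegral_eq_integral_of_forall_compl_eq_zero hout
    rw [h2]
    simp only [smul_sub]
    rw [integral_sub (hint ψ hψ) (hψi.integrableOn.smul_const k), integral_smul_const, h3]
    exact h1
  have hae := isOpen_Ioo.ae_eq_zero_of_integral_contDiff_smul_eq_zero (U := Ioo 0 T)
    (f := fun t => h t - k) (μ := volume)
    ((hh.sub (integrableOn_const (by simp))).locallyIntegrableOn)
    fun ψ h1 h2 h3 => hsub ψ ⟨h1, h2, h3⟩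
  rw [ae_restrict_iff' measurableSet_Ioo]
  filter_upwards [hae] with t ht htT
  exact sub_eq_zero.1 (ht htT)

/-- A curve in a dual space with integrable weak derivative is a primitive of it. -/
theorem exists_ae_eq_add_integral {H : Type*} [NormedAddCommGroup H] [NormedSpace ℝ H]
    (hT : 0 < T) {h h' : ℝ → StrongDual ℝ H} (hh : IntegrableOn h (Ioo 0 T))
    (hh' : IntegrableOn h' (Ioo 0 T))
    (hd : ∀ φ : ℝ → ℝ, IsTestFunction (Ioo 0 T) φ →
      ∫ t in Ioo 0 T, deriv φ t • h t = -∫ t in Ioo 0 T, φ t • h' t) :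
    ∃ k, ∀ᵐ t ∂(volume.restrict (Ioo 0 T)), h t = k + ∫ s in (0 : ℝ)..t, h' s := by
  have hii : IntervalIntegrable h' volume 0 T := by
    rwa [intervalIntegrable_iff_integrableOn_Ioo_of_le hT.le]
  have hGc : ContinuousOn (fun t => ∫ s in (0 : ℝ)..t, h' s) (Icc 0 T) := by
    have := intervalIntegral.continuousOn_primitive_interval' hii left_mem_uIcc
    rwa [uIcc_of_le hT.le] at this
  have hGi : IntegrableOn (fun t => ∫ s in (0 : ℝ)..t, h' s) (Ioo 0 T) :=
    (hGc.integrableOn_compact isCompact_Icc).mono_set Ioo_subset_Icc_self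
  have hbd : ∀ {g : ℝ → StrongDual ℝ H}, IntegrableOn g (Ioo 0 T) → ∀ {φ : ℝ → ℝ},
      Continuous φ → HasCompactSupport φ → IntegrableOn (fun t => φ t • g t) (Ioo 0 T) := by
    intro g hg φ hφ hφc
    obtain ⟨K, hK⟩ := hφ.bounded_above_of_compact_support hφc
    exact hg.bdd_smul K hφ.aestronglyMeasurable (Eventually.of_forall hK)
  have hparts : ∀ φ : ℝ → ℝ, IsTestFunction (Ioo 0 T) φ →
      ∫ t in Ioo 0 T, deriv φ t • (∫ s in (0 : ℝ)..t, h' s) = -∫ t in Ioo 0 T, φ t • h' t := by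
    intro φ hφ
    have hφ' : Continuous (deriv φ) := hφ.contDiff.continuous_deriv (by simp)
    have hout : ∀ t, t ∉ Ioo 0 T → φ t = 0 := fun t ht =>
      image_eq_zero_of_notMem_tsupport fun h => ht (hφ.tsupport_subset h)
    -- Evaluating at `ξ` reduces to integration by parts for real absolutely continuous functions.
    ext ξ
    rw [neg_apply, ContinuousLinearMap.integral_apply (hbd hGi hφ' hφ.hasCompactSupport.deriv),
      ContinuousLinearMap.integral_apply (hbd hh' hφ.contDiff.continuous hφ.hasCompactSupport)]
    have hξi : IntervalIntegrable (fun t => h' t ξ) volume 0 T :=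
      ⟨(ContinuousLinearMap.apply ℝ ℝ ξ).integrable_comp hii.1,
        (ContinuousLinearMap.apply ℝ ℝ ξ).integrable_comp hii.2⟩
    have hAC := hξi.absolutelyContinuousOnInterval_intervalIntegral (c := 0) left_mem_uIcc
    have hACφ : AbsolutelyContinuousOnInterval φ 0 T :=
      (hφ.contDiff.of_le (by simp)).contDiffOn.absolutelyContinuousOnInterval
    have hip := hAC.integral_mul_deriv_eq_deriv_mul hACφ
    rw [hout 0 (by simp), hout T (by simp), mul_zero, mul_zero, sub_zero, zero_sub,
      intervalIntegral.integral_of_le hT.le, intervalIntegral.integral_of_le hT.le,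
      integral_Ioc_eq_integral_Ioo, integral_Ioc_eq_integral_Ioo] at hip
    have e1 : ∫ t in Ioo 0 T, (deriv φ t • (∫ s in (0 : ℝ)..t, h' s)) ξ =
        ∫ t in Ioo 0 T, (∫ s in (0 : ℝ)..t, h' s ξ) * deriv φ t := by
      refine setIntegral_congr_fun measurableSet_Ioo fun t ht => ?_
      have hti : IntervalIntegrable h' volume 0 t :=
        hii.mono_set (by rw [uIcc_of_le ht.1.le, uIcc_of_le hT.le]; exact Icc_subset_Icc_right ht.2.le)
      simp only [smul_apply, smul_eq_mul]
      rw [ContinuousLinearMap.intervalIntegral_apply hti, mul_comm]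
    have e2 : ∫ t in Ioo 0 T, (φ t • h' t) ξ =
        ∫ t in Ioo 0 T, deriv (fun t => ∫ s in (0 : ℝ)..t, h' s ξ) t * φ t := by
      refine setIntegral_congr_ae measurableSet_Ioo ?_
      filter_upwards [hξi.ae_hasDerivAt_integral] with t ht htT
      rw [uIcc_of_le hT.le] at ht
      rw [(ht (Ioo_subset_Icc_self htT) 0 (left_mem_Icc.2 hT.le)).deriv]
      simp [mul_comm]
    rw [e1, e2]
    exact hip
  obtain ⟨k, hk⟩ := exists_ae_eq_const_of_integral_deriv_smul_eq_zero hT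
    (h := fun t => h t - ∫ s in (0 : ℝ)..t, h' s) (hh.sub hGi) (by
      intro φ hφ
      have hφ' : Continuous (deriv φ) := hφ.contDiff.continuous_deriv (by simp)
      simp only [smul_sub]
      rw [integral_sub (hbd hh hφ' hφ.hasCompactSupport.deriv)
        (hbd hGi hφ' hφ.hasCompactSupport.deriv), hd φ hφ, hparts φ hφ, sub_self])
  refine ⟨k, ?_⟩
  filter_upwards [hk] with t ht
  rw [← ht, sub_add_cancel]

end DuBoisReymond

/-! ### Chaining along good times -/

section Chaining

variable {T : ℝ} {A : Set ℝ} {P : ℝ → ℝ}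

/-- An integrable function is at most its average somewhere off any null set. -/
theorem exists_mem_mul_le_integral (hA : ∀ᵐ t ∂(volume.restrict (Ioo 0 T)), t ∈ A)
    (hP : Integrable P) {a b : ℝ} (ha : 0 ≤ a) (hab : a < b) (hb : b ≤ T) :
    ∃ t ∈ A, t ∈ Ioo a b ∧ (b - a) * P t ≤ ∫ s in a..b, P s := by
  have hsub : Ioo a b ⊆ Ioo 0 T := Ioo_subset_Ioo ha hb
  have hnull : volume.restrict (Ioo a b) (A ∩ Ioo a b)ᶜ = 0 := by
    have h1 : ∀ᵐ t ∂(volume.restrict (Ioo a b)), t ∈ A :=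
      ae_restrict_of_ae_restrict_of_subset hsub hA
    have h2 : ∀ᵐ t ∂(volume.restrict (Ioo a b)), t ∈ A ∩ Ioo a b := by
      filter_upwards [h1, ae_restrict_mem measurableSet_Ioo] with t h3 h4 using ⟨h3, h4⟩
    exact h2
  have hne : volume.restrict (Ioo a b) ≠ 0 := by
    rw [Ne, Measure.restrict_eq_zero]
    simpa using hab
  obtain ⟨t, ht, hle⟩ := exists_notMem_null_le_average hne hP.integrableOn hnull
  rw [notMem_compl_iff] at ht
  refine ⟨t, ht.1, ht.2, ?_⟩
  rw [setAverage_eq, Real.volume_real_Ioo_of_le hab.le, smul_eq_mul, inv_mul_eq_div,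
    le_div_iff₀ (by linarith)] at hle
  rw [intervalIntegral.integral_of_le hab.le, integral_Ioc_eq_integral_Ioo]
  linarith

/-- Increments controlled along good times by `∫ P` and by the endpoint values of `P` are
controlled by `∫ P` alone. -/
theorem abs_sub_le_of_chain (hA : ∀ᵐ t ∂(volume.restrict (Ioo 0 T)), t ∈ A)
    (hAT : A ⊆ Ioo 0 T) (hP : Integrable P) (hP0 : ∀ t, 0 ≤ P t) {F : ℝ → ℝ} {K : ℝ}
    (hK : 0 ≤ K) (hF : ∀ s ∈ A, ∀ t ∈ A, s < t →
      |F t - F s| ≤ K * ((∫ r in s..t, P r) + (t - s) * (P s + P t)))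
    {s t : ℝ} (hs : s ∈ A) (ht : t ∈ A) (hst : s < t) :
    |F t - F s| ≤ 6 * K * ∫ r in s..t, P r := by
  have hii : ∀ a b, IntervalIntegrable P volume a b := fun a b => hP.intervalIntegrable
  have hadd : ∀ a b c, (∫ r in a..b, P r) + (∫ r in b..c, P r) = ∫ r in a..c, P r :=
    fun a b c => intervalIntegral.integral_add_adjacent_intervals (hii a b) (hii b c)
  have hnn : ∀ {a b : ℝ}, a ≤ b → 0 ≤ ∫ r in a..b, P r := fun h =>
    intervalIntegral.integral_nonneg h fun r _ => hP0 r
  have hs0 := (hAT hs).1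
  have htT := (hAT ht).2
  have key : ∀ n : ℕ, |F t - F s| ≤ 6 * K * (∫ r in s..t, P r) +
      K * (t - s) * (P s + P t) / (n + 1) := by
    intro n
    set h : ℝ := (t - s) / (n + 1) with hh
    have hh0 : 0 < h := div_pos (by linarith) (by positivity)
    have hnh : s + (n + 1) * h = t := by rw [hh]; field_simp; ring
    let x : ℕ → ℝ := fun i => s + i * h
    have hx1 : ∀ i, x (i + 1) = x i + h := fun i => by simp only [x]; push_cast; ring
    have hxs : ∀ i, s ≤ x i := fun i => by
      simp only [x]
      have : 0 ≤ (i : ℝ) * h := by positivity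
      linarith
    have hxt : ∀ i, i ≤ n → x (i + 1) ≤ t := fun i hi => by
      rw [← hnh]
      simp only [x]
      have : ((i + 1 : ℕ) : ℝ) ≤ n + 1 := by exact_mod_cast Nat.succ_le_succ hi
      have := mul_le_mul_of_nonneg_right this hh0.le
      linarith
    have hcell : ∀ i, ∃ τ, i ≤ n → τ ∈ A ∧ τ ∈ Ioo (x i) (x (i + 1)) ∧
        h * P τ ≤ ∫ r in (x i)..(x (i + 1)), P r := by
      intro i
      by_cases hi : i ≤ n
      · obtain ⟨τ, h1, h2, h3⟩ := exists_mem_mul_le_integral hA hP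
          (hs0.le.trans (hxs i)) (show x i < x (i + 1) by rw [hx1]; linarith)
          ((hxt i hi).trans htT.le)
        refine ⟨τ, fun _ => ⟨h1, h2, ?_⟩⟩
        rwa [hx1, add_sub_cancel_left, ← hx1] at h3
      · exact ⟨0, fun h => absurd h hi⟩
    choose τ hτ using hcell
    -- A jump from `τ i` to `τ (i + 1)` costs three times `K` times the integral over both cells:
    -- once for `∫ P` and twice for the endpoint terms, the jump being at most `2h` long. Completed
    -- cells are met by two jumps, hence the 6; the current one by a single jump, hence the 3.
    have hstep : ∀ i, i ≤ n → |F (τ i) - F s| ≤ K * h * P s + 6 * K * (∫ r in s..(x i), P r) +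
        3 * K * ∫ r in (x i)..(x (i + 1)), P r := by
      intro i
      induction i with
      | zero =>
        intro hi
        obtain ⟨h1, h2, h3⟩ := hτ 0 hi
        have hx0 : x 0 = s := by simp [x]
        rw [hx0] at h2 h3 ⊢
        have h4 := hF s hs (τ 0) h1 h2.1
        have h5 : ∫ r in s..(τ 0), P r ≤ ∫ r in s..(x (0 + 1)), P r := by
          rw [← hadd s (τ 0) (x (0 + 1))]
          linarith [hnn h2.2.le]
        have h6 : τ 0 - s ≤ h := by
          have := hx1 0
          rw [hx0] at this
          linarith [h2.2]
        have h7 : (τ 0 - s) * (P s + P (τ 0)) ≤ h * (P s + P (τ 0)) :=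
          mul_le_mul_of_nonneg_right h6 (add_nonneg (hP0 _) (hP0 _))
        rw [intervalIntegral.integral_same]
        have h8 := mul_le_mul_of_nonneg_left (add_le_add h5 h7) hK
        have h9 := mul_le_mul_of_nonneg_left h3 hK
        have h10 : 0 ≤ K * ∫ r in s..(x (0 + 1)), P r :=
          mul_nonneg hK (hnn (hxs _))
        nlinarith
      | succ i ih =>
        intro hi
        have ih := ih (by omega)
        obtain ⟨h1, h2, h3⟩ := hτ i (by omega)
        obtain ⟨h1', h2', h3'⟩ := hτ (i + 1) hi
        have h4 := hF (τ i) h1 (τ (i + 1)) h1' (h2.2.trans h2'.1)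
        have h5 : ∫ r in (τ i)..(τ (i + 1)), P r ≤
            (∫ r in (x i)..(x (i + 1)), P r) + ∫ r in (x (i + 1))..(x (i + 1 + 1)), P r := by
          rw [hadd, ← hadd (x i) (τ i) (x (i + 1 + 1)),
            ← hadd (τ i) (τ (i + 1)) (x (i + 1 + 1))]
          linarith [hnn h2.1.le, hnn h2'.2.le]
        have h6 : τ (i + 1) - τ i ≤ 2 * h := by
          linarith [h2.1, h2'.2, hx1 i, hx1 (i + 1)]
        have h7 : (τ (i + 1) - τ i) * (P (τ i) + P (τ (i + 1))) ≤
            2 * h * (P (τ i) + P (τ (i + 1))) :=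
          mul_le_mul_of_nonneg_right h6 (add_nonneg (hP0 _) (hP0 _))
        have h8 := mul_le_mul_of_nonneg_left (add_le_add h5 h7) hK
        have h9 := mul_le_mul_of_nonneg_left h3 hK
        have h9' := mul_le_mul_of_nonneg_left h3' hK
        have h10 : |F (τ (i + 1)) - F s| ≤ |F (τ (i + 1)) - F (τ i)| + |F (τ i) - F s| :=
          abs_sub_le _ _ _
        rw [← hadd s (x i) (x (i + 1))]
        linarith
    obtain ⟨h1, h2, h3⟩ := hτ n le_rfl
    have hxn : x (n + 1) = t := by
      rw [← hnh]; simp only [x]; push_cast; ring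
    have hn := hstep n le_rfl
    rw [hxn] at h2 h3 hn
    have h4 := hF (τ n) h1 t ht h2.2
    have h5 : ∫ r in (τ n)..t, P r ≤ ∫ r in (x n)..t, P r := by
      rw [← hadd (x n) (τ n) t]
      linarith [hnn h2.1.le]
    have h6 : t - τ n ≤ h := by linarith [h2.1, hx1 n]
    have h7 : (t - τ n) * (P (τ n) + P t) ≤ h * (P (τ n) + P t) :=
      mul_le_mul_of_nonneg_right h6 (add_nonneg (hP0 _) (hP0 _))
    have h8 := mul_le_mul_of_nonneg_left (add_le_add h5 h7) hK
    have h9 := mul_le_mul_of_nonneg_left h3 hK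
    have h10 : |F t - F s| ≤ |F t - F (τ n)| + |F (τ n) - F s| := abs_sub_le _ _ _
    have h11 : 0 ≤ K * ∫ r in (x n)..t, P r := mul_nonneg hK (hnn (h2.1.trans h2.2).le)
    have h12 : K * (t - s) * (P s + P t) / (n + 1) = K * h * P s + K * h * P t := by
      rw [hh]; ring
    rw [h12, ← hadd s (x n) t]
    linarith
  -- Refining the subdivision kills the values of `P` at the fixed endpoints `s` and `t`.
  have hlim : Tendsto (fun n : ℕ => 6 * K * (∫ r in s..t, P r) +
      K * (t - s) * (P s + P t) / (n + 1)) atTop (𝓝 (6 * K * (∫ r in s..t, P r) + 0)) := by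
    refine tendsto_const_nhds.add ?_
    have := (tendsto_const_div_atTop_nhds_zero_nat (K * (t - s) * (P s + P t))).comp
      (tendsto_add_atTop_nat 1)
    refine this.congr fun n => ?_
    simp
  rw [add_zero] at hlim
  exact ge_of_tendsto' hlim key

theorem exists_seq_mem_tendsto (hA : ∀ᵐ t ∂(volume.restrict (Ioo 0 T)), t ∈ A)
    (hP : Integrable P) (hP0 : ∀ t, 0 ≤ P t) (hT : 0 < T) {t : ℝ} (ht : t ∈ Icc 0 T) :
    ∃ σ : ℕ → ℝ, (∀ n, σ n ∈ A) ∧ Tendsto σ atTop (𝓝 t) ∧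
      Tendsto (fun n => |σ n - t| * P (σ n)) atTop (𝓝 0) := by
  -- The windows `[a n, b n]` contain `t`, stay in `[0, T]` and have length `T/(n+1) > 0`, including
  -- when `t` is an endpoint.
  let a : ℕ → ℝ := fun n => t - t / (n + 1)
  let b : ℕ → ℝ := fun n => t + (T - t) / (n + 1)
  have hdiv : ∀ r : ℝ, Tendsto (fun n : ℕ => r / (n + 1)) atTop (𝓝 0) := fun r =>
    ((tendsto_const_div_atTop_nhds_zero_nat r).comp (tendsto_add_atTop_nat 1)).congr
      fun n => by simp
  have ha : Tendsto a atTop (𝓝 t) := by simpa using! (hdiv t).const_sub t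
  have hb : Tendsto b atTop (𝓝 t) := by simpa using! (hdiv (T - t)).const_add t
  have hle : ∀ (r : ℝ), 0 ≤ r → ∀ n : ℕ, r / (n + 1) ≤ r := fun r hr n =>
    div_le_self hr (by linarith [n.cast_nonneg (α := ℝ)])
  have hat : ∀ n, a n ≤ t := fun n => by
    have : 0 ≤ t / ((n : ℝ) + 1) := div_nonneg ht.1 (by positivity)
    simp only [a]; linarith
  have hbt : ∀ n, t ≤ b n := fun n => by
    have : 0 ≤ (T - t) / ((n : ℝ) + 1) := div_nonneg (by linarith [ht.2]) (by positivity)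
    simp only [b]; linarith
  have hlt : ∀ n, a n < b n := fun n => by
    have h1 : b n - a n = T / (n + 1) := by simp only [a, b]; ring
    have : 0 < T / ((n : ℝ) + 1) := by positivity
    linarith
  have hex := fun n => exists_mem_mul_le_integral hA hP (a := a n) (b := b n)
    (by have := hle t ht.1 n; simp only [a]; linarith) (hlt n)
    (by have := hle (T - t) (by linarith [ht.2]) n; simp only [b]; linarith)
  choose σ hσA hσI hσP using hex
  refine ⟨σ, hσA, ?_, ?_⟩
  · exact tendsto_of_tendsto_of_tendsto_of_le_of_le ha hb (fun n => (hσI n).1.le)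
      (fun n => (hσI n).2.le)
  · have hΦ : Continuous fun x => ∫ r in (0 : ℝ)..x, P r :=
      intervalIntegral.continuous_primitive (fun _ _ => hP.intervalIntegrable) 0
    have hlim : Tendsto (fun n => ∫ r in (a n)..(b n), P r) atTop (𝓝 0) := by
      have h1 := ((hΦ.tendsto t).comp hb).sub ((hΦ.tendsto t).comp ha)
      rw [sub_self] at h1
      refine h1.congr fun n => ?_
      exact intervalIntegral.integral_interval_sub_left hP.intervalIntegrable
        hP.intervalIntegrable
    refine squeeze_zero (fun n => mul_nonneg (abs_nonneg _) (hP0 _)) (fun n => ?_) hlim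
    refine le_trans (mul_le_mul_of_nonneg_right ?_ (hP0 _)) (hσP n)
    rw [abs_le]
    constructor <;> linarith [(hσI n).1, (hσI n).2, hat n, hbt n]

/-- Cauchy-Schwarz, by expanding the nonnegative integral of `((t - s) g - m)²`. -/
theorem sq_integral_le {g : ℝ → ℝ} {s t : ℝ} (hst : s < t)
    (hg : IntervalIntegrable g volume s t)
    (hg2 : IntervalIntegrable (fun r => g r ^ 2) volume s t) :
    (∫ r in s..t, g r) ^ 2 ≤ (t - s) * ∫ r in s..t, g r ^ 2 := by
  set m := ∫ r in s..t, g r with hm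
  have hts : 0 < t - s := by linarith
  have h1 : 0 ≤ ∫ r in s..t, ((t - s) * g r - m) ^ 2 :=
    intervalIntegral.integral_nonneg hst.le fun r _ => sq_nonneg _
  have h2 : ∫ r in s..t, ((t - s) * g r - m) ^ 2 =
      (t - s) ^ 2 * (∫ r in s..t, g r ^ 2) - (t - s) * m ^ 2 := by
    have h3 : ∀ r, ((t - s) * g r - m) ^ 2 =
        (t - s) ^ 2 * g r ^ 2 - 2 * (t - s) * m * g r + m ^ 2 := fun r => by ring
    simp_rw [h3]
    rw [intervalIntegral.integral_add ((hg2.const_mul _).sub (hg.const_mul _))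
      intervalIntegrable_const, intervalIntegral.integral_sub (hg2.const_mul _) (hg.const_mul _),
      intervalIntegral.integral_const_mul, intervalIntegral.integral_const_mul, ← hm,
      intervalIntegral.integral_const, smul_eq_mul]
    ring
  rw [h2] at h1
  have h4 : (t - s) * m ^ 2 ≤ (t - s) * ((t - s) * ∫ r in s..t, g r ^ 2) := by nlinarith
  exact le_of_mul_le_mul_left h4 hts

theorem AbsolutelyContinuousOnInterval.of_dist_le {F Φ : ℝ → ℝ} {a b K : ℝ}
    (hΦ : AbsolutelyContinuousOnInterval Φ a b)
    (h : ∀ s ∈ uIcc a b, ∀ t ∈ uIcc a b, dist (F s) (F t) ≤ K * dist (Φ s) (Φ t)) :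
    AbsolutelyContinuousOnInterval F a b := by
  have h1 : Tendsto _ _ (𝓝 (K * 0)) := Tendsto.const_mul K hΦ
  rw [mul_zero] at h1
  refine squeeze_zero' (Eventually.of_forall fun E => Finset.sum_nonneg fun i _ => dist_nonneg)
    ?_ h1
  refine eventually_inf_principal.2 (Eventually.of_forall fun E hE => ?_)
  rw [Finset.mul_sum]
  exact Finset.sum_le_sum fun i hi => h _ (hE.1 i hi).1 _ (hE.1 i hi).2

end Chaining

/-! ### The abstract chain rule -/

section ChainRule

theorem cauchySeq_of_norm_sub_sq_le {H : Type*} [NormedAddCommGroup H] {u : ℕ → H} {β : ℕ → ℝ}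
    (hβ : Tendsto β atTop (𝓝 0)) (h : ∀ n m, ‖u n - u m‖ ^ 2 ≤ β n + β m) : CauchySeq u := by
  rw [Metric.cauchySeq_iff]
  intro e he
  obtain ⟨n₀, hn₀⟩ := eventually_atTop.1 (hβ.eventually (gt_mem_nhds (show 0 < e ^ 2 / 2 by positivity)))
  refine ⟨n₀, fun m hm n hn => ?_⟩
  rw [dist_eq_norm]
  refine lt_of_pow_lt_pow_left₀ 2 he.le ?_
  linarith [h m n, hn₀ m hm, hn₀ n hn]

theorem hasDerivAt_norm_sub_sq {V : Type*} [NormedAddCommGroup V] [NormedSpace ℝ V]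
    {G : ℝ → V} {g : V} {t : ℝ} (hG : HasDerivAt G g t) :
    HasDerivAt (fun s => ‖G s - G t‖ ^ 2) 0 t := by
  rw [hasDerivAt_iff_isLittleO]
  simp only [sub_self, norm_zero, smul_zero, sub_zero, ne_eq, OfNat.ofNat_ne_zero,
    not_false_eq_true, zero_pow]
  have h1 : (fun s => G s - G t) =O[𝓝 t] fun s => s - t := hG.hasFDerivAt.isBigO_sub
  have h2 := h1.norm_left.pow 2
  refine h2.trans_isLittleO ?_
  have h3 : (fun s : ℝ => s - t) =o[𝓝 t] fun _ => (1 : ℝ) := by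
    rw [Asymptotics.isLittleO_one_iff]
    have : ContinuousAt (fun s : ℝ => s - t) t := by fun_prop
    simpa [ContinuousAt] using this
  simpa [sq] using h3.mul_isBigO (Asymptotics.isBigO_refl (fun s : ℝ => s - t) (𝓝 t))

/-- The chain rule for a functional `E` that is semiconvex, on bounded sets, with respect to the
seminorm `‖J ·‖`, with subgradients given by the relation `IsPot`. -/
theorem exists_representative_hasDerivAt {H : Type*} [NormedAddCommGroup H] [NormedSpace ℝ H]
    [CompleteSpace H] (J : H →L[ℝ] StrongDual ℝ H)
    {E : H → ℝ} (hE : Continuous E) {IsPot : H → H → Prop} {κ : ℝ} (hκ : 0 < κ)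
    (key : ∀ M : ℝ, ∃ K ≥ 0, ∀ a b m : H, ‖a‖ ≤ M → ‖b‖ ≤ M → IsPot a m →
      κ * ‖b - a‖ ^ 2 - K * ‖J (b - a)‖ ^ 2 ≤ E b - E a - J (b - a) m)
    {T : ℝ} (hT : 0 < T) {c : ℝ → H} (hc : MemLp c ⊤ (volume.restrict (Ioo 0 T)))
    {c' : ℝ → StrongDual ℝ H} (hc' : MemLp c' 2 (volume.restrict (Ioo 0 T)))
    (hcc' : ∀ φ : ℝ → ℝ, IsTestFunction (Ioo 0 T) φ →
      ∫ t in Ioo 0 T, deriv φ t • J (c t) = -∫ t in Ioo 0 T, φ t • c' t)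
    {μ : ℝ → H} (hμ : MemLp μ 2 (volume.restrict (Ioo 0 T)))
    (hcμ : ∀ᵐ t ∂(volume.restrict (Ioo 0 T)), IsPot (c t) (μ t)) :
    ∃ cc : ℝ → H, (∀ᵐ t ∂(volume.restrict (Ioo 0 T)), cc t = c t) ∧
      ContinuousOn (fun t => J (cc t)) (Icc 0 T) ∧ (∃ M, ∀ t ∈ Icc 0 T, ‖cc t‖ ≤ M) ∧
      AbsolutelyContinuousOnInterval (fun t => E (cc t)) 0 T ∧
      ∀ᵐ t ∂(volume.restrict (Ioo 0 T)), HasDerivAt (fun s => E (cc s)) (c' t (μ t)) t := by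
  set M : ℝ := (eLpNorm c ⊤ (volume.restrict (Ioo 0 T))).toReal with hMdef
  have hM : ∀ᵐ t ∂(volume.restrict (Ioo 0 T)), ‖c t‖ ≤ M := by
    filter_upwards [ae_le_eLpNormEssSup (f := c) (μ := volume.restrict (Ioo 0 T))] with t ht
    rw [← eLpNorm_exponent_top] at ht
    have := ENNReal.toReal_mono hc.eLpNorm_lt_top.ne ht
    rwa [toReal_enorm] at this
  obtain ⟨K, hK0, hK⟩ := key M
  have hind : EqOn ((Ioo 0 T).indicator c') c' (Ioo 0 T) := fun t ht => indicator_of_mem ht _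
  -- Extension by zero makes the primitives below continuous on the whole line.
  set d' := (Ioo 0 T).indicator c' with hd'
  have hc'i : IntegrableOn c' (Ioo 0 T) := hc'.integrable one_le_two
  have hd'i : Integrable d' := by
    have h := (integrable_indicator_iff (ε' := StrongDual ℝ H) (μ := volume) (f := c')
      measurableSet_Ioo).2 hc'i
    exact h
  set P : ℝ → ℝ := (Ioo 0 T).indicator (fun t => ‖c' t‖ ^ 2 + ‖μ t‖ ^ 2) with hPdef
  have hP : Integrable P := (integrable_indicator_iff measurableSet_Ioo).2
    ((hc'.integrable_norm_pow two_ne_zero).add (hμ.integrable_norm_pow two_ne_zero))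
  have hP0 : ∀ t, 0 ≤ P t := fun t => indicator_nonneg (fun _ _ => by positivity) t
  have hd'P : ∀ t, ‖d' t‖ ^ 2 ≤ P t := fun t => by
    by_cases ht : t ∈ Ioo 0 T
    · simp only [hd', hPdef, indicator_of_mem ht]
      linarith [sq_nonneg ‖μ t‖]
    · simp [hd', hPdef, indicator_of_notMem ht]
  have hμP : ∀ t ∈ Ioo 0 T, ‖μ t‖ ^ 2 ≤ P t := fun t ht => by
    simp only [hPdef, indicator_of_mem ht]
    linarith [sq_nonneg ‖c' t‖]
  obtain ⟨k, hk⟩ := exists_ae_eq_add_integral hT (h := fun t => J (c t)) (h' := d')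
    (J.integrable_comp (hc.integrable le_top)) hd'i.integrableOn (by
      intro φ hφ
      rw [hcc' φ hφ]
      congr 1
      exact setIntegral_congr_fun measurableSet_Ioo fun t ht => by
        simp only [hind ht])
  set G : ℝ → StrongDual ℝ H := fun t => ∫ s in (0 : ℝ)..t, d' s with hGdef
  set Φ : ℝ → ℝ := fun t => ∫ s in (0 : ℝ)..t, P s with hΦdef
  have hGc : Continuous G :=
    intervalIntegral.continuous_primitive (fun _ _ => hd'i.intervalIntegrable) 0
  have hΦc : Continuous Φ :=
    intervalIntegral.continuous_primitive (fun _ _ => hP.intervalIntegrable) 0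
  have hGsub : ∀ s t, G t - G s = ∫ r in s..t, d' r := fun s t =>
    intervalIntegral.integral_interval_sub_left hd'i.intervalIntegrable hd'i.intervalIntegrable
  have hΦsub : ∀ s t, Φ t - Φ s = ∫ r in s..t, P r := fun s t =>
    intervalIntegral.integral_interval_sub_left hP.intervalIntegrable hP.intervalIntegrable
  have hd'2 : Integrable fun t => ‖d' t‖ ^ 2 := by
    refine hP.mono' (hd'i.aestronglyMeasurable.norm.pow 2) (Eventually.of_forall fun t => ?_)
    rw [Real.norm_of_nonneg (sq_nonneg _)]
    exact hd'P t
  have hGΦ : ∀ s t, ‖G t - G s‖ ^ 2 ≤ |t - s| * |Φ t - Φ s| := by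
    have hlt : ∀ s t, s < t → ‖G t - G s‖ ^ 2 ≤ |t - s| * |Φ t - Φ s| := by
      intro s t hst
      have h1 : ‖G t - G s‖ ≤ ∫ r in s..t, ‖d' r‖ := by
        rw [hGsub]
        exact intervalIntegral.norm_integral_le_integral_norm hst.le
      have h2 := sq_integral_le hst hd'i.norm.intervalIntegrable hd'2.intervalIntegrable
      have h3 : ∫ r in s..t, ‖d' r‖ ^ 2 ≤ Φ t - Φ s := by
        rw [hΦsub]
        exact intervalIntegral.integral_mono_on hst.le hd'2.intervalIntegrable
          hP.intervalIntegrable fun r _ => hd'P r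
      calc ‖G t - G s‖ ^ 2 ≤ (∫ r in s..t, ‖d' r‖) ^ 2 := by gcongr
        _ ≤ _ := h2
        _ ≤ (t - s) * (Φ t - Φ s) := by
          gcongr
        _ ≤ _ := by
          rw [abs_of_pos (by linarith : 0 < t - s)]
          gcongr
          exact le_abs_self _
    intro s t
    rcases lt_trichotomy s t with h | h | h
    · exact hlt s t h
    · simp [h]
    · rw [norm_sub_rev, abs_sub_comm t, abs_sub_comm (Φ t)]
      exact hlt t s h
  set A : Set ℝ := {t | t ∈ Ioo 0 T ∧ ‖c t‖ ≤ M ∧ IsPot (c t) (μ t) ∧ J (c t) = k + G t} with hAdef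
  have hA : ∀ᵐ t ∂(volume.restrict (Ioo 0 T)), t ∈ A := by
    filter_upwards [ae_restrict_mem measurableSet_Ioo, hM, hcμ, hk] with t h1 h2 h3 h4
    exact ⟨h1, h2, h3, h4⟩
  have hAT : A ⊆ Ioo 0 T := fun t ht => ht.1
  -- The 1 pays for the pairing with `μ s`, and `K * T` for the quadratic `H¹*` term, since `|t - s|
  -- ≤ T`.
  set K₀ : ℝ := 1 + K * T with hK₀
  have hK₀0 : 0 ≤ K₀ := by positivity
  have hbasic : ∀ s ∈ A, ∀ t ∈ A, κ * ‖c t - c s‖ ^ 2 + E (c s) - E (c t) ≤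
      K₀ * (|Φ t - Φ s| + |t - s| * P s) := by
    intro s hs t ht
    have h1 := hK (c s) (c t) (μ s) hs.2.1 ht.2.1 hs.2.2.1
    have hJ : J (c t - c s) = G t - G s := by
      rw [map_sub, hs.2.2.2, ht.2.2.2]; abel
    rw [hJ] at h1
    have h2 := hGΦ s t
    have h3 : -((G t - G s) (μ s)) ≤ ‖G t - G s‖ * ‖μ s‖ :=
      (neg_le_abs _).trans ((G t - G s).le_opNorm (μ s))
    have h4 : ‖G t - G s‖ * ‖μ s‖ ≤ |Φ t - Φ s| + |t - s| * P s := by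
      have hQ : 0 ≤ |Φ t - Φ s| := abs_nonneg _
      have hR : 0 ≤ |t - s| * P s := mul_nonneg (abs_nonneg _) (hP0 s)
      refine le_of_sq_le_sq ?_ (by positivity)
      calc (‖G t - G s‖ * ‖μ s‖) ^ 2 = ‖G t - G s‖ ^ 2 * ‖μ s‖ ^ 2 := by ring
        _ ≤ (|t - s| * |Φ t - Φ s|) * P s := by
          gcongr
          exact hμP s hs.1
        _ = |Φ t - Φ s| * (|t - s| * P s) := by ring
        _ ≤ _ := by nlinarith
    have h5 : |t - s| ≤ T := by
      rw [abs_le]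
      constructor <;> linarith [hs.1.1, hs.1.2, ht.1.1, ht.1.2]
    have h6 : K * ‖G t - G s‖ ^ 2 ≤ K * T * (|Φ t - Φ s| + |t - s| * P s) := by
      rw [mul_assoc]
      refine mul_le_mul_of_nonneg_left (h2.trans ?_) hK0
      refine mul_le_mul h5 ?_ (abs_nonneg _) hT.le
      exact le_add_of_nonneg_right (mul_nonneg (abs_nonneg _) (hP0 s))
    rw [hK₀]
    linarith
  have hE1 : ∀ s ∈ A, ∀ t ∈ A, |E (c t) - E (c s)| ≤ 6 * K₀ * |Φ t - Φ s| := by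
    have hlt : ∀ s ∈ A, ∀ t ∈ A, s < t → |E (c t) - E (c s)| ≤ 6 * K₀ * |Φ t - Φ s| := by
      intro s hs t ht hst
      have hmono : ∀ s t, s < t → |Φ t - Φ s| = ∫ r in s..t, P r := fun s t hst => by
        rw [hΦsub, abs_of_nonneg]
        exact intervalIntegral.integral_nonneg hst.le fun r _ => hP0 r
      rw [hmono s t hst]
      refine abs_sub_le_of_chain hA hAT hP hP0 (F := fun t => E (c t)) hK₀0 ?_ hs ht hst
      intro s hs t ht hst
      have h1 := hbasic s hs t ht
      have h2 := hbasic t ht s hs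
      rw [abs_sub_comm (Φ s), abs_sub_comm s t] at h2
      rw [hmono s t hst, abs_of_pos (by linarith : 0 < t - s)] at h1 h2
      have h3 : 0 ≤ κ * ‖c t - c s‖ ^ 2 := by positivity
      have h4 : 0 ≤ κ * ‖c s - c t‖ ^ 2 := by positivity
      have h5 : 0 ≤ K₀ * ((t - s) * P s) :=
        mul_nonneg hK₀0 (mul_nonneg (by linarith) (hP0 s))
      have h6 : 0 ≤ K₀ * ((t - s) * P t) :=
        mul_nonneg hK₀0 (mul_nonneg (by linarith) (hP0 t))
      rw [abs_le]
      constructor <;> nlinarith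
    intro s hs t ht
    rcases lt_trichotomy s t with h | h | h
    · exact hlt s hs t ht h
    · simp [h]
    · rw [abs_sub_comm (E (c t)), abs_sub_comm (Φ t)]
      exact hlt t ht s hs h
  have hrep : ∀ t ∈ Icc 0 T, ∃ x : H, ∃ σ : ℕ → ℝ, (∀ n, σ n ∈ A) ∧ Tendsto σ atTop (𝓝 t) ∧
      Tendsto (fun n => c (σ n)) atTop (𝓝 x) ∧ (t ∈ A → x = c t) := by
    intro t ht
    -- At good times the constant sequence is used, so that `cc` agrees with `c` there.
    by_cases htA : t ∈ A
    · exact ⟨c t, fun _ => t, fun _ => htA, tendsto_const_nhds, tendsto_const_nhds, fun _ => rfl⟩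
    obtain ⟨σ, hσA, hσt, hσP⟩ := exists_seq_mem_tendsto hA hP hP0 hT ht
    set β : ℕ → ℝ := fun n => 7 * K₀ / κ * (|Φ (σ n) - Φ t| + 2 * (|σ n - t| * P (σ n)))
      with hβ
    have hβ0 : Tendsto β atTop (𝓝 0) := by
      have h1 : Tendsto (fun n => |Φ (σ n) - Φ t|) atTop (𝓝 0) := by
        have := (((hΦc.tendsto t).comp hσt).sub_const (Φ t)).abs
        simpa using this
      simpa using (h1.add (hσP.const_mul 2)).const_mul (7 * K₀ / κ)
    -- The subgradient inequality is based at whichever time is farther from `t`: then `|σ m - σ n|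
    -- ≤ 2 |σ n - t|`, and the factor `P (σ n)` is compensated by the choice of `σ`. The constant 7
    -- is 6 from the energy increment plus 1 from `hbasic`.
    have hpair : ∀ n m, |σ m - t| ≤ |σ n - t| → ‖c (σ n) - c (σ m)‖ ^ 2 ≤ β n + β m := by
      intro n m hnm
      have h1 := hbasic (σ n) (hσA n) (σ m) (hσA m)
      have h2 := (abs_le.1 (hE1 (σ n) (hσA n) (σ m) (hσA m))).2
      have h3 : |Φ (σ m) - Φ (σ n)| ≤ |Φ (σ n) - Φ t| + |Φ (σ m) - Φ t| := by
        rw [abs_sub_comm (Φ (σ n)), add_comm]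
        exact abs_sub_le _ _ _
      have h4 : |σ m - σ n| ≤ 2 * |σ n - t| := by
        have := abs_sub_le (σ m) t (σ n)
        rw [abs_sub_comm t] at this
        linarith
      have h5 : |σ m - σ n| * P (σ n) ≤ 2 * (|σ n - t| * P (σ n)) := by
        rw [← mul_assoc]
        exact mul_le_mul_of_nonneg_right h4 (hP0 _)
      have h6 : 0 ≤ |σ m - σ n| * P (σ n) := mul_nonneg (abs_nonneg _) (hP0 _)
      have h7 : 0 ≤ |σ m - t| * P (σ m) := mul_nonneg (abs_nonneg _) (hP0 _)
      have h8 : κ * ‖c (σ n) - c (σ m)‖ ^ 2 ≤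
          7 * K₀ * (|Φ (σ m) - Φ (σ n)| + |σ m - σ n| * P (σ n)) := by
        rw [norm_sub_rev]
        nlinarith [mul_nonneg hK₀0 h6]
      have h9 : 7 * K₀ * (|Φ (σ m) - Φ (σ n)| + |σ m - σ n| * P (σ n)) ≤
          7 * K₀ * ((|Φ (σ n) - Φ t| + 2 * (|σ n - t| * P (σ n))) +
            (|Φ (σ m) - Φ t| + 2 * (|σ m - t| * P (σ m)))) :=
        mul_le_mul_of_nonneg_left (by linarith) (by positivity)
      have h10 : β n + β m = 7 * K₀ * ((|Φ (σ n) - Φ t| + 2 * (|σ n - t| * P (σ n))) +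
            (|Φ (σ m) - Φ t| + 2 * (|σ m - t| * P (σ m)))) / κ := by
        simp only [hβ]; ring
      rw [h10, le_div_iff₀ hκ]
      linarith
    have hcau : CauchySeq fun n => c (σ n) := by
      refine cauchySeq_of_norm_sub_sq_le hβ0 fun n m => ?_
      rcases le_total (|σ m - t|) (|σ n - t|) with h | h
      · exact hpair n m h
      · rw [norm_sub_rev, add_comm]
        exact hpair m n h
    obtain ⟨x, hx⟩ := cauchySeq_tendsto_of_complete hcau
    exact ⟨x, σ, hσA, hσt, hx, fun h => absurd h htA⟩
  choose! cc σ hσA hσt hσc hccA using hrep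
  have hcc : ∀ t ∈ A, cc t = c t := fun t ht =>
    hccA t (Ioo_subset_Icc_self (hAT ht)) ht
  have hJcc : ∀ t ∈ Icc 0 T, J (cc t) = k + G t := by
    intro t ht
    have h1 : Tendsto (fun n => J (c (σ t n))) atTop (𝓝 (J (cc t))) :=
      (J.continuous.tendsto _).comp (hσc t ht)
    have h2 : Tendsto (fun n => k + G (σ t n)) atTop (𝓝 (k + G t)) :=
      ((hGc.tendsto t).comp (hσt t ht)).const_add k
    refine tendsto_nhds_unique h1 (h2.congr fun n => ?_)
    exact (hσA t ht n).2.2.2.symm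
  have hccM : ∀ t ∈ Icc 0 T, ‖cc t‖ ≤ M := fun t ht =>
    le_of_tendsto' (hσc t ht).norm fun n => (hσA t ht n).2.1
  have hEcc : ∀ s ∈ Icc 0 T, ∀ t ∈ Icc 0 T,
      |E (cc t) - E (cc s)| ≤ 6 * K₀ * |Φ t - Φ s| := by
    intro s hs t ht
    have hEt : ∀ r ∈ Icc 0 T, Tendsto (fun n => E (c (σ r n))) atTop (𝓝 (E (cc r))) :=
      fun r hr => (hE.tendsto _).comp (hσc r hr)
    have hΦt : ∀ r ∈ Icc 0 T, Tendsto (fun n => Φ (σ r n)) atTop (𝓝 (Φ r)) :=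
      fun r hr => (hΦc.tendsto _).comp (hσt r hr)
    exact le_of_tendsto_of_tendsto' ((hEt t ht).sub (hEt s hs)).abs
      (((hΦt t ht).sub (hΦt s hs)).abs.const_mul _)
      fun n => hE1 _ (hσA s hs n) _ (hσA t ht n)
  have hAC : AbsolutelyContinuousOnInterval (fun t => E (cc t)) 0 T := by
    have hΦAC : AbsolutelyContinuousOnInterval Φ 0 T :=
      hP.intervalIntegrable.absolutelyContinuousOnInterval_intervalIntegral left_mem_uIcc
    refine AbsolutelyContinuousOnInterval.of_dist_le (K := 6 * K₀) hΦAC fun s hs t ht => ?_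
    rw [uIcc_of_le hT.le] at hs ht
    rw [Real.dist_eq, Real.dist_eq]
    exact hEcc t ht s hs
  refine ⟨cc, ?_, ?_, ⟨M, hccM⟩, hAC, ?_⟩
  · filter_upwards [hA] with t ht using hcc t ht
  · exact (continuous_const.add hGc).continuousOn.congr hJcc
  · filter_upwards [hA, ae_restrict_of_ae hAC.ae_differentiableAt,
      ae_restrict_of_ae (hd'i.intervalIntegrable (a := 0) (b := T)).ae_hasDerivAt_integral]
      with t htA hdiff hderiv
    have htI : t ∈ Icc 0 T := Ioo_subset_Icc_self htA.1
    rw [uIcc_of_le hT.le] at hdiff hderiv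
    have hG : HasDerivAt G (c' t) t := by
      have := hderiv htI 0 (left_mem_Icc.2 hT.le)
      rwa [hind htA.1] at this
    have hF := (hdiff htI).hasDerivAt
    have hGμ : HasDerivAt (fun s => (G s - G t) (μ t)) (c' t (μ t)) t := by
      have h1 := ((ContinuousLinearMap.apply ℝ ℝ (μ t)).hasFDerivAt.comp_hasDerivAt t
        (hG.sub_const (G t)))
      exact h1
    have hR : HasDerivAt (fun s => E (cc s) - (G s - G t) (μ t) + K * ‖G s - G t‖ ^ 2)
        (deriv (fun t => E (cc t)) t - c' t (μ t) + K * 0) t :=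
      (hF.sub hGμ).add ((hasDerivAt_norm_sub_sq hG).const_mul K)
    -- The subgradient inequality based at the good time `t`, with its nonnegative `κ` term dropped,
    -- holds at all nearby times; at `s = t` both corrections vanish.
    have hmin : IsLocalMin
        (fun s => E (cc s) - (G s - G t) (μ t) + K * ‖G s - G t‖ ^ 2) t := by
      filter_upwards [Ioo_mem_nhds htA.1.1 htA.1.2] with s hs
      have hsI : s ∈ Icc 0 T := Ioo_subset_Icc_self hs
      have h1 := hK (c t) (cc s) (μ t) htA.2.1 (hccM s hsI) htA.2.2.1
      have hJ : J (cc s - c t) = G s - G t := by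
        rw [map_sub, hJcc s hsI, htA.2.2.2]; abel
      rw [hJ] at h1
      have h2 : 0 ≤ κ * ‖cc s - c t‖ ^ 2 := by positivity
      simp only [sub_self, zero_apply, norm_zero, hcc t htA, ne_eq,
        OfNat.ofNat_ne_zero, not_false_eq_true, zero_pow, mul_zero, add_zero, sub_zero]
      linarith
    have h0 := hmin.hasDerivAt_eq_zero hR
    have heq : deriv (fun t => E (cc t)) t = c' t (μ t) := by linarith
    rwa [heq] at hF

end ChainRule

/-! ### Completeness of `H¹(Ω)`, the dual embedding and the main theorem -/

variable {Ω : Set (EuclideanSpace ℝ (Fin N))}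

/-- For a fixed test function and direction the weak-gradient identity equates two `L²` inner
products with fixed vectors, hence is a closed condition. -/
theorem isClosed_H1 : IsClosed (H1 Ω : Set (WithLp 2 (L2 Ω × L2Vec Ω))) := by
  have hset : (H1 Ω : Set (WithLp 2 (L2 Ω × L2Vec Ω))) =
      ⋂ (φ : EuclideanSpace ℝ (Fin N) → ℝ) (_ : IsTestFunction Ω φ) (v : EuclideanSpace ℝ (Fin N)),
        {w | ∫ x in Ω, w.fst x * fderiv ℝ φ x v = -∫ x in Ω, ⟪w.snd x, v⟫ * φ x} := by
    ext w
    simp only [mem_iInter]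
    rfl
  rw [hset]
  refine isClosed_iInter fun φ => isClosed_iInter fun hφ => isClosed_iInter fun v => ?_
  have hm1 : MemLp (fun x => fderiv ℝ φ x v) 2 (volume.restrict Ω) :=
    ((hφ.contDiff.continuous_fderiv (by simp)).clm_apply
      continuous_const).memLp_of_hasCompactSupport
        (hφ.hasCompactSupport.fderiv_apply (𝕜 := ℝ) v)
  have hm2 : MemLp (fun x => φ x • v) 2 (volume.restrict Ω) :=
    (hφ.contDiff.continuous.smul continuous_const).memLp_of_hasCompactSupport
      hφ.hasCompactSupport.smul_right
  have e1 : ∀ u : L2 Ω, ∫ x in Ω, u x * fderiv ℝ φ x v = ⟪u, hm1.toLp⟫ := fun u => by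
    rw [L2_inner_eq]
    refine integral_congr_ae ?_
    filter_upwards [hm1.coeFn_toLp] with x hx
    rw [hx]
  have e2 : ∀ g : L2Vec Ω, ∫ x in Ω, ⟪g x, v⟫ * φ x = ⟪g, hm2.toLp⟫ := fun g => by
    rw [L2.inner_def]
    refine integral_congr_ae ?_
    filter_upwards [hm2.coeFn_toLp] with x hx
    rw [hx, inner_smul_right, mul_comm]
  simp_rw [e1, e2]
  exact isClosed_eq
    ((WithLp.fstL 2 ℝ (L2 Ω) (L2Vec Ω)).continuous.inner continuous_const)
    ((WithLp.sndL 2 ℝ (L2 Ω) (L2Vec Ω)).continuous.inner continuous_const).neg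

theorem completeSpace_H1 : CompleteSpace (H1 Ω) :=
  isClosed_H1.completeSpace_coe

/-- The embedding `H¹(Ω) → H¹(Ω)*` as a continuous linear map. -/
noncomputable def H1.toDualL : H1 Ω →L[ℝ] StrongDual ℝ (H1 Ω) :=
  LinearMap.mkContinuous
    { toFun := H1.toDual
      map_add' := fun u v => by
        ext ξ
        rw [add_apply, H1.toDual_apply_eq_inner, H1.toDual_apply_eq_inner,
          H1.toDual_apply_eq_inner, map_add, inner_add_left]
      map_smul' := fun a u => by
        ext ξ
        rw [RingHom.id_apply, smul_apply, H1.toDual_apply_eq_inner,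
          H1.toDual_apply_eq_inner, map_smul, real_inner_smul_left, smul_eq_mul] } 1
    fun u => by
      refine ContinuousLinearMap.opNorm_le_bound (H1.toDual u)
        (mul_nonneg zero_le_one (norm_nonneg u)) fun ξ => ?_
      rw [H1.toDual_apply_eq_inner, one_mul]
      exact (norm_inner_le_norm _ _).trans (mul_le_mul (H1.norm_toL2_le u) (H1.norm_toL2_le ξ)
        (norm_nonneg _) (norm_nonneg _))

theorem H1.toDualL_apply (u : H1 Ω) : H1.toDualL u = H1.toDual u := rfl

/-- The interpolation `H1.norm_toL2_sq_le` upgrades continuity in `H¹*` to continuity in `L²` on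
`H¹`-bounded sets. -/
theorem continuousOn_toL2_of_toDualL {s : Set ℝ} {u : ℝ → H1 Ω}
    (hJ : ContinuousOn (fun t => H1.toDualL (u t)) s) {M : ℝ} (hM : ∀ t ∈ s, ‖u t‖ ≤ M) :
    ContinuousOn (fun t => H1.toL2 (u t)) s := by
  intro t ht
  have h1 : Tendsto (fun r => ‖H1.toDualL (u r) - H1.toDualL (u t)‖ * (2 * M)) (𝓝[s] t) (𝓝 0) := by
    have h := (tendsto_iff_norm_sub_tendsto_zero (E := StrongDual ℝ (H1 Ω))).1 (hJ t ht)
    have h' := h.mul_const (2 * M)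
    rwa [zero_mul] at h'
  have h2 : Tendsto (fun r => ‖H1.toL2 (u r) - H1.toL2 (u t)‖ ^ 2) (𝓝[s] t) (𝓝 0) := by
    refine squeeze_zero' (Eventually.of_forall fun r => sq_nonneg _) ?_ h1
    filter_upwards [self_mem_nhdsWithin] with r hr
    rw [← map_sub, ← map_sub, H1.toDualL_apply]
    refine (H1.norm_toL2_sq_le _).trans ?_
    refine mul_le_mul_of_nonneg_left ?_ (norm_nonneg (H1.toDual (u r - u t)))
    linarith [norm_sub_le (u r) (u t), hM r hr, hM t ht]
  have h3 := h2.sqrt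
  simp only [Real.sqrt_sq (norm_nonneg _), Real.sqrt_zero] at h3
  exact tendsto_iff_norm_sub_tendsto_zero.2 h3

end CahnHilliard

/-- The curve `c` is given up to null sets of times; `cc` is its representative that is
continuous in time. -/
theorem mainTheorem5 {N : ℕ} (hN : 1 ≤ N) (Ω : Set (EuclideanSpace ℝ (Fin N)))
    (hΩ_open : IsOpen Ω) (hΩ_bdd : Bornology.IsBounded Ω) (hΩ : CahnHilliard.HasC2Boundary Ω)
    (f : ℝ → ℝ) (hf : CahnHilliard.IsAdmissiblePotential N f)
    (ε T : ℝ) (hε : 0 < ε) (hT : 0 < T)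
    (c : ℝ → CahnHilliard.H1 Ω)
    (hc_H1 : MemLp c ⊤ (volume.restrict (Ioo 0 T)))
    (hc_H2 : CahnHilliard.MemL2H2 T c)
    (c' : ℝ → StrongDual ℝ (CahnHilliard.H1 Ω))
    (hc' : MemLp c' 2 (volume.restrict (Ioo 0 T)))
    (hcc' : CahnHilliard.IsWeakTimeDeriv T c c')
    (μ : ℝ → CahnHilliard.H1 Ω)
    (hμ : MemLp μ 2 (volume.restrict (Ioo 0 T)))
    (hcμ : ∀ᵐ t ∂(volume.restrict (Ioo 0 T)),
      CahnHilliard.IsChemicalPotential f ε (c t) (μ t)) :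
    ∃ cc : ℝ → CahnHilliard.H1 Ω,
      (∀ᵐ t ∂(volume.restrict (Ioo 0 T)), cc t = c t) ∧
      ContinuousOn (fun t => CahnHilliard.H1.toL2 (cc t)) (Icc 0 T) ∧
      (∀ t ∈ Icc 0 T,
        Integrable (fun x => f (CahnHilliard.H1.toL2 (cc t) x)) (volume.restrict Ω)) ∧
      AbsolutelyContinuousOnInterval (fun t => CahnHilliard.energy f ε (cc t)) 0 T ∧
      ∀ᵐ t ∂(volume.restrict (Ioo 0 T)),
        HasDerivAt (fun s => CahnHilliard.energy f ε (cc s)) (c' t (μ t)) t := by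
  obtain ⟨pS, pT, δ, C, hpS, -, -, -, hC, hbd⟩ := hf.bounds
  have hg : CahnHilliard.HasGrowth f pS C :=
    ⟨hf.contDiff, hpS.two_lt, hC, fun s => (hbd s).2⟩
  obtain ⟨S, hS⟩ := CahnHilliard.exists_sobolev_constant hN hΩ_open hΩ_bdd hΩ hpS
  have hS' : CahnHilliard.HasSobolevBound Ω pS S := hS
  have : IsFiniteMeasure (volume.restrict Ω) := ⟨by simpa using hΩ_bdd.measure_lt_top⟩
  have : CompleteSpace (CahnHilliard.H1 Ω) := CahnHilliard.completeSpace_H1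
  obtain ⟨cc, h1, h2, ⟨M, hM⟩, h3, h4⟩ := CahnHilliard.exists_representative_hasDerivAt
    CahnHilliard.H1.toDualL (E := CahnHilliard.energy f ε)
    (continuous_iff_continuousAt.2 fun v => hg.tendsto_energy hS' Filter.tendsto_id)
    (IsPot := CahnHilliard.IsChemicalPotential f ε) (κ := ε / 4) (by positivity)
    (hg.exists_energy_sub_ge hS' hε) hT hc_H1 hc' hcc' hμ hcμ
  exact ⟨cc, h1, CahnHilliard.continuousOn_toL2_of_toDualL h2 hM,
    fun t _ => hg.integrable_comp hS' (cc t), h3, h4⟩
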